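/- Let $q$ be a prime power and let $\ell, k, n, r, \delta, L_{\mathsf c}, a$ be integers with $\ell\ge 1$, $0<k<n$, $\delta\ge 1$, $a\ge 0$, $k=L_{\mathsf c}r$ and $n=L_{\mathsf c}(r+\delta-1)+a$. Let $\boldsymbol P_1,\dots,\boldsymbol P_{L_{\mathsf c}}$ be $(\delta-1)\times r$ matrices and $\boldsymbol M_1,\dots,\boldsymbol M_{L_{\mathsf c}}$ be $a\times r$ matrices over $\mathrm{GF}(q)$. Let $\mathcal C\subseteq \mathrm{GF}(q)^n$ be an $[n,k]$ linear code which, for a suitable order of the coordinates, has the parity-check matrix $$\boldsymbol H=\left(\begin{array}{ccccccc|c} \boldsymbol P_1&\boldsymbol I_{\delta-1}&&&&&&\\ &&\boldsymbol P_2&\boldsymbol I_{\delta-1}&&&&\\ &&&&\ddots&&&\\ &&&&&\boldsymbol P_{L_{\mathsf c}}&\boldsymbol I_{\delta-1}&\\ \hline \boldsymbol M_1&\boldsymbol 0&\boldsymbol M_2&\boldsymbol 0&\cdots&\boldsymbol M_{L_{\mathsf c}}&\boldsymbol 0&\boldsymbol I_a\end{array}\right).$$ For $j=1,\dots,L_{\mathsf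 c}$ let $\mathcal S_j$ be the set of the $r+\delta-1$ coordinates in the $j$-th group of columns $(\boldsymbol P_j\,|\,\boldsymbol I_{\delta-1})$. Assume that $\mathcal C$ is a distance-optimal $(r,\delta)$ information locality code with local coordinate sets $\mathcal S_j$: these sets are disjoint, their union contains an information set of $\mathcal C$, and each punctured code $\mathcal C|_{\mathcal S_j}$ is an $[r+\delta-1,r]$ MDS code of minimum distance $\delta$ with parity-check matrix $(\boldsymbol P_j\,|\,\boldsymbol I_{\delta-1})$. Assume moreover that $$\boldsymbol H^{\mathsf{MDS}}=\left(\begin{array}{cccc|cc}\boldsymbol P_1&\boldsymbol P_2&\cdots&\boldsymbol P_{L_{\mathsf c}}&\boldsymbol I_{\delta-1}&\boldsymbol 0\\ \boldsymbol M_1&\boldsymbol M_2&\cdots&\boldsymbol M_{L_{\mathsf c}}&\boldsymbol 0&\boldsymbol I_a\end{array}\right)$$ is the parity-check matrix of an $[n',k]$ MDS code, where $n'=n-(L_{\mathsf c}-1)(\delta-1)$. Then there is a binary $n\times n$ matrix $\boldsymbol E$ all of whose rows and columns have weight $n-k$ and each of whose rows is the indicator of an erasure pattern that $\mathcal C$ can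 correct. Furthermore $\mathcal C$ is MDS-PIR capacity-achieving, in the following sense. Let $f$ files, each a $\beta\times k$ matrix over $\mathrm{GF}(q^\ell)$, be stored on $n$ noncolluding nodes by encoding each row of each file with a fixed generator matrix of $\mathcal C$ and storing the $i$-th code symbols on node $i$. In a linear private information retrieval (PIR) protocol the user, who wants one file, sends to each node a random query matrix over $\mathrm{GF}(q)$, and the node returns the linear combinations of its stored symbols given by the rows of that matrix. The distribution of the query to any single node must not depend on which file is wanted, and the wanted file must be determined without error by the queries and the responses. The rate of the protocol is $\beta k$ divided by the total number of downloaded $\mathrm{GF}(q^\ell)$-symbols. For every generator matrix of $\mathcal C$: 1. for every $f\ge 1$ there is, for some $\beta$, a linear PIR protocol of rate exactly $\mathsf C_f=\dfrac{1-k/n}{1-(k/n)^f}$; 2. there are a number $\beta$ and numbers of symbols downloaded from the nodes, none of them depending on $f$, and linear PIR protocols with these parameters, one for each $f$, whose rates tend to $\mathsf C_\infty=1-k/n$ as $f\to\infty$. -/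

import Mathlib

/-! ## Linear codes

A linear code with coordinate set `ι` over the field `F` is a subspace of `ι → F`. -/

/-- Minimum Hamming distance between two distinct codewords. -/
noncomputable def minDist {F ι : Type*} [Field F] [DecidableEq F] [Fintype ι]
    (C : Submodule F (ι → F)) : ℕ :=
  sInf {w | ∃ x ∈ C, ∃ y ∈ C, x ≠ y ∧ w = hammingDist x y}

/-- The rows of `G` form a basis of the code `C`. -/
def IsGeneratorMatrix {F ι κ : Type*} [Field F] (G : Matrix κ ι F)
    (C : Submodule F (ι → F)) : Prop :=
  LinearIndependent F G.row ∧ Submodule.span F (Set.range G.row) = C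

/-- `H` is a parity-check matrix of `C`: its rows are linearly independent and `C` is the set of
vectors `x` with `H x = 0`. -/
def IsParityCheckMatrix {F ι κ : Type*} [Field F] [Fintype ι] (H : Matrix κ ι F)
    (C : Submodule F (ι → F)) : Prop :=
  LinearIndependent F H.row ∧ C = LinearMap.ker H.mulVecLin

/-- `C` is an `[N, k]` maximum distance separable code, where `N` is the number of coordinates:
it has dimension `k` and its minimum distance meets the Singleton bound. -/
def IsMDS {F ι : Type*} [Field F] [DecidableEq F] [Fintype ι]
    (C : Submodule F (ι → F)) (k : ℕ) : Prop :=
  Module.finrank F C = k ∧ minDist C = Fintype.card ι - k + 1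

/-- The punctured code which keeps the coordinates `g x`, listed by `x : κ`. -/
def puncture {F ι κ : Type*} [Field F] (C : Submodule F (ι → F)) (g : κ → ι) :
    Submodule F (κ → F) :=
  C.map (LinearMap.funLeft F F g)

/-- The punctured code `C|_S`. -/
def punctureTo {F ι : Type*} [Field F] (C : Submodule F (ι → F)) (S : Finset ι) :
    Submodule F (S → F) :=
  puncture C (fun x : S => (x : ι))

/-- The erasure pattern `e` (`true` marks an erasure) is correctable by `C`: a codeword is determined
by its entries at the positions that are not erased. -/
def IsCorrectable {F ι : Type*} [Field F] (C : Submodule F (ι → F)) (e : ι → Bool) : Prop :=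
  ∀ x ∈ C, ∀ y ∈ C, (∀ i, e i = false → x i = y i) → x = y

/-! ## Local reconstruction codes -/

/-- `C` is an `(r, δ)` information locality code with local coordinate sets `S j`. The rank of the
columns of a generator matrix in a set of positions is the dimension of the punctured code. -/
structure IsInformationLocalityCode {F : Type*} [Field F] [DecidableEq F] {n L : ℕ}
    (C : Submodule F (Fin n → F)) (r δ : ℕ) (S : Fin L → Finset (Fin n)) : Prop where
  card_le : ∀ j, (S j).card ≤ r + δ - 1
  le_minDist : ∀ j, δ ≤ minDist (punctureTo C (S j))
  rank_union : Module.finrank F (punctureTo C (Finset.univ.biUnion S)) = Module.finrank F C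

/-- Coordinates of a code with `L` local groups, each with `r` information symbols and `δ - 1` local
parities, and with `a` global parities. -/
abbrev LRCCoord (L r δ a : ℕ) : Type := (Fin L × (Fin r ⊕ Fin (δ - 1))) ⊕ Fin a

/-- The matrix
```
( P₁ I          |   )
(      P₂ I     |   )
(          ⋱    |   )
( M₁ 0 M₂ 0 ... | I )
```
-/
def lrcParityCheck {F : Type*} [Field F] {L r δ a : ℕ}
    (P : Fin L → Matrix (Fin (δ - 1)) (Fin r) F) (M : Fin L → Matrix (Fin a) (Fin r) F) :
    Matrix ((Fin L × Fin (δ - 1)) ⊕ Fin a) (LRCCoord L r δ a) F :=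
  Matrix.fromBlocks
    (Matrix.of fun i x => if i.1 = x.1 then Matrix.fromCols (P i.1) 1 i.2 x.2 else 0) 0
    (Matrix.of fun i x => Matrix.fromCols (M x.1) 0 i x.2) 1

/-- The matrix
```
( P₁ P₂ ... P_L |   )
( M₁ M₂ ... M_L | I )
```
-/
def stackedParityCheck {F : Type*} [Field F] {L r δ a : ℕ}
    (P : Fin L → Matrix (Fin (δ - 1)) (Fin r) F) (M : Fin L → Matrix (Fin a) (Fin r) F) :
    Matrix (Fin (δ - 1) ⊕ Fin a) ((Fin L × Fin r) ⊕ (Fin (δ - 1) ⊕ Fin a)) F :=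
  Matrix.fromCols
    (Matrix.fromRows (Matrix.of fun i x => P x.1 i x.2) (Matrix.of fun i x => M x.1 i x.2)) 1

/-- The positions of the `j`-th local code, when `e` matches the positions of the code with the
columns of the block parity-check matrix. -/
def localCoord {n L r δ a : ℕ} (e : Fin n ≃ LRCCoord L r δ a) (j : Fin L) :
    Fin r ⊕ Fin (δ - 1) → Fin n :=
  fun x => e.symm (Sum.inl (j, x))

/-- The coordinate set of the `j`-th local code. -/
def localSet {n L r δ a : ℕ} (e : Fin n ≃ LRCCoord L r δ a) (j : Fin L) : Finset (Fin n) :=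
  Finset.univ.image (localCoord e j)

/-- `C` is a distance-optimal `(r, δ)` information locality code with blocks `P j`, `M j`; `e` matches
the positions of the code with the columns of the block parity-check matrix. -/
structure IsDistanceOptimalLRC {F : Type*} [Field F] [DecidableEq F] {n L r δ a : ℕ}
    (C : Submodule F (Fin n → F)) (e : Fin n ≃ LRCCoord L r δ a)
    (P : Fin L → Matrix (Fin (δ - 1)) (Fin r) F) (M : Fin L → Matrix (Fin a) (Fin r) F) :
    Prop where
  locality : IsInformationLocalityCode C r δ (localSet e)
  local_mds : ∀ j, IsMDS (puncture C (localCoord e j)) r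
  local_parityCheck : ∀ j,
    IsParityCheckMatrix (Matrix.fromCols (P j) 1) (puncture C (localCoord e j))
  local_minDist : ∀ j, minDist (puncture C (localCoord e j)) = δ
  disjoint : ∀ j j', j ≠ j' → Disjoint (localSet e j) (localSet e j')
  parityCheck : IsParityCheckMatrix ((lrcParityCheck P M).submatrix id e) C

/-! ## Private information retrieval -/

/-- `f` files, each a `β × k` matrix over `K`. -/
abbrev Files (K : Type*) (f β k : ℕ) : Type _ := Fin f → Matrix (Fin β) (Fin k) K

/-- The symbol which node `l` stores for row `b` of file `m`: every row of every file is encoded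
with the generator matrix `G` over the subfield `F`, and node `l` stores the `l`-th entries. -/
def storedSymbol {F K : Type*} [Field F] [Field K] [Algebra F K] {n k f β : ℕ}
    (G : Matrix (Fin k) (Fin n) F) (X : Files K f β k) (l : Fin n) (m : Fin f) (b : Fin β) : K :=
  (X m * G.map (algebraMap F K)) b l

/-- The response of node `l` to the query matrix `Q`: each row of `Q` asks for one linear
combination of the symbols which the node stores. -/
def response {F K : Type*} [Field F] [Field K] [Algebra F K] {n k f β d : ℕ}
    (G : Matrix (Fin k) (Fin n) F) (X : Files K f β k) (l : Fin n)
    (Q : Matrix (Fin d) (Fin f × Fin β) F) : Fin d → K :=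
  fun i => ∑ p : Fin f × Fin β, algebraMap F K (Q i p) * storedSymbol G X l p.1 p.2

/-- A linear PIR protocol for `f` files with `β` rows each, encoded with `G` and stored on `n`
noncolluding nodes, which downloads `d l` symbols of `K` from node `l`. -/
structure PIRProtocol {F : Type*} (K : Type*) [Field F] [Field K] [Algebra F K] {n k : ℕ}
    (G : Matrix (Fin k) (Fin n) F) (f β : ℕ) (d : Fin n → ℕ) where
  /-- The joint distribution of the queries to the `n` nodes when file `m` is requested. -/
  query : Fin f → PMF ((l : Fin n) → Matrix (Fin (d l)) (Fin f × Fin β) F)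
  /-- Privacy: the distribution of the query seen by one node does not depend on the requested
  file. -/
  privacy : ∀ l m m', (query m).map (fun Q => Q l) = (query m').map (fun Q => Q l)
  /-- Retrieval: the requested file is computed without error from the responses and the queries. -/
  retrieval : ∀ m, ∀ Q ∈ (query m).support,
    ∃ decode : ((l : Fin n) → Fin (d l) → K) → Matrix (Fin β) (Fin k) K,
      ∀ X : Files K f β k, decode (fun l => response G X l (Q l)) = X m

/-- The PIR rate: size of a file divided by the number of downloaded symbols, both counted in
symbols of `K`. -/
noncomputable def PIRProtocol.rate {F K : Type*} [Field F] [Field K] [Algebra F K] {n k : ℕ}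
    {G : Matrix (Fin k) (Fin n) F} {f β : ℕ} {d : Fin n → ℕ} (_ : PIRProtocol K G f β d) : ℝ :=
  ((β : ℝ) * k) / ∑ l, (d l : ℝ)

/-- The finite MDS-PIR capacity of `f` files. -/
noncomputable def finiteCapacity (n k f : ℕ) : ℝ := (1 - (k : ℝ) / n) / (1 - ((k : ℝ) / n) ^ f)

/-- The asymptotic MDS-PIR capacity. -/
noncomputable def asymptoticCapacity (n k : ℕ) : ℝ := 1 - (k : ℝ) / n

/-- For every number of files there is a PIR protocol whose rate is the finite capacity. -/
def AchievesFiniteCapacity {F : Type*} (K : Type*) [Field F] [Field K] [Algebra F K] {n k : ℕ}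
    (G : Matrix (Fin k) (Fin n) F) : Prop :=
  ∀ f : ℕ, 1 ≤ f → ∃ (β : ℕ) (d : Fin n → ℕ) (T : PIRProtocol K G f β d),
    T.rate = finiteCapacity n k f

/-- There are PIR protocols, one for each number of files, whose rates tend to the asymptotic
capacity and whose numbers of rows per file and of downloaded symbols do not depend on the number
of files. -/
def AchievesAsymptoticCapacity {F : Type*} (K : Type*) [Field F] [Field K] [Algebra F K] {n k : ℕ}
    (G : Matrix (Fin k) (Fin n) F) : Prop :=
  ∃ (β : ℕ) (d : Fin n → ℕ) (T : (f : ℕ) → PIRProtocol K G f β d),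
    Filter.Tendsto (fun f => (T f).rate) Filter.atTop (nhds (asymptoticCapacity n k))

/-- Storage with generator matrix `G` achieves both MDS-PIR capacities. -/
def IsMDSPIRCapacityAchieving {F : Type*} (K : Type*) [Field F] [Field K] [Algebra F K] {n k : ℕ}
    (G : Matrix (Fin k) (Fin n) F) : Prop :=
  AchievesFiniteCapacity K G ∧ AchievesAsymptoticCapacity K G

/-- A binary `n × n` matrix with all row and column weights equal to `w`. -/
def IsRegularBinaryMatrix {n : ℕ} (E : Matrix (Fin n) (Fin n) Bool) (w : ℕ) : Prop :=
  (∀ i, (Finset.univ.filter fun j => E i j = true).card = w) ∧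
    ∀ j, (Finset.univ.filter fun i => E i j = true).card = w

/-! The existence of `E` is a statement about the matroid of the columns of a generator matrix: it
needs `n` bases which cover every position exactly `k` times, and `E` consists of their complements.
By Edmonds' matroid intersection theorem (`IsRankFunction.exists_common_independent`), applied to a
direct sum of `n` copies of the matroid and to the bound `k` on multiplicities, such bases exist as
soon as every set `S` of positions has rank at least `k * |S| / n`
(`IsRankFunction.exists_uniform_cover`). Applied to the words which vanish on `S`, this means that
every subcode of dimension `κ` has a support of at least `κ * n / k` positions.

For this bound (`finrank_mul_card_le`) the supports are estimated in two ways. Projected to a local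
group, the subcode is a subcode of a code of minimum distance `δ`. Those of its words which live on a
set `T` of local groups and on the global parities become words of the stacked MDS code when the
parities of the groups are added up; this loses nothing if `T` is a single group, and at most the
parities of the groups in `T` otherwise. With `T` a smallest set of groups on which a nonzero word is
concentrated, these estimates suffice (`finrank_mul_le_of_group_bounds`).

The protocols only use `n` information sets `B s` such that every node lies in `k` of them. The nodes
of an information set download an interfering combination of rows of other files. Its encoding is a
codeword over the extension field, so it is then known at the remaining nodes, which download it
together with a row of the requested file; each row of the requested file is in turn downloaded from
all nodes of an information set (`exists_decode`). If the interference is uniformly random, the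
queries to each node are uniformly distributed, which gives the rate `1 - k / n` independently of the
number of files (`nonempty_pirProtocol_of_uniform`). For the finite capacity, the interference
consists of sums of distinct rows, one from each file in a set of files. The numbers of sums over
each set of files are balanced so that a node sees the same pattern whichever file is requested, and
random permutations of the rows of each file hide the rest
(`nonempty_pirProtocol_of_permutation`). -/

/-! ### Matroid intersection -/

/-- `ρ` is the rank function of a matroid: normalized, monotone and submodular, with values at most
one on singletons. The independent sets are the `I` with `ρ I = |I|`. -/
structure IsRankFunction {α : Type*} [DecidableEq α] (ρ : Finset α → ℕ) : Prop where
  empty : ρ ∅ = 0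
  mono : ∀ ⦃S T⦄, S ⊆ T → ρ S ≤ ρ T
  singleton_le : ∀ e, ρ {e} ≤ 1
  submodular : ∀ S T, ρ (S ∪ T) + ρ (S ∩ T) ≤ ρ S + ρ T

namespace IsRankFunction

variable {α : Type*} [DecidableEq α] {ρ ρ₁ ρ₂ : Finset α → ℕ}

theorem insert_le (h : IsRankFunction ρ) (e : α) (S : Finset α) : ρ (insert e S) ≤ ρ S + ρ {e} := by
  have h1 := h.submodular {e} S
  rw [← Finset.insert_eq] at h1
  omega

theorem le_card (h : IsRankFunction ρ) (S : Finset α) : ρ S ≤ S.card := by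
  induction S using Finset.induction_on with
  | empty => simp [h.empty]
  | insert e S he ih =>
    rw [Finset.card_insert_of_notMem he]
    have := h.insert_le e S
    have := h.singleton_le e
    omega

/-- Contraction of an element which is not a loop. -/
theorem contract (h : IsRankFunction ρ) {e : α} (he : ρ {e} = 1) :
    IsRankFunction fun S => ρ (insert e S) - 1 where
  empty := by simp [he]
  mono S T hST := Nat.sub_le_sub_right (h.mono (Finset.insert_subset_insert e hST)) 1
  singleton_le x := by
    have h1 := h.insert_le e {x}
    have h2 := h.singleton_le x
    omega
  submodular S T := by
    have h1 := h.submodular (insert e S) (insert e T)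
    rw [← Finset.insert_union_distrib, ← Finset.insert_inter_distrib] at h1
    have h2 : ∀ U, 1 ≤ ρ (insert e U) := fun U => by
      rw [← he]; exact h.mono (by simp)
    have := h2 (S ∪ T); have := h2 (S ∩ T); have := h2 S; have := h2 T
    omega

/-- Edmonds' matroid intersection theorem: two matroids have a common independent set of size `k`
in `A` as soon as `k ≤ ρ₁ U + ρ₂ (A \ U)` for all `U ⊆ A`. If deleting and contracting an element
both destroy this condition, the two violating sets can be uncrossed. -/
theorem exists_common_independent (h₁ : IsRankFunction ρ₁) (h₂ : IsRankFunction ρ₂) (A : Finset α)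
    (k : ℕ) (hk : ∀ U ⊆ A, k ≤ ρ₁ U + ρ₂ (A \ U)) :
    ∃ I ⊆ A, I.card = k ∧ ρ₁ I = k ∧ ρ₂ I = k := by
  induction A using Finset.induction_on generalizing ρ₁ ρ₂ k with
  | empty =>
    have := hk ∅ (by simp)
    simp only [h₁.empty, h₂.empty, Finset.sdiff_self] at this
    refine ⟨∅, by simp, ?_⟩
    simp only [Finset.card_empty, h₁.empty, h₂.empty]
    omega
  | insert e A he ih =>
    by_cases hdel : ∀ U ⊆ A, k ≤ ρ₁ U + ρ₂ (A \ U)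
    · obtain ⟨I, hI, h⟩ := ih h₁ h₂ k hdel
      exact ⟨I, hI.trans (Finset.subset_insert e A), h⟩
    push Not at hdel
    obtain ⟨U, hU, hUk⟩ := hdel
    have heU : e ∉ U := fun h => he (hU h)
    have hs1 : insert e A \ insert e U = A \ U := by
      ext x; simp only [Finset.mem_sdiff, Finset.mem_insert]; grind
    have hs2 : insert e A \ U = insert e (A \ U) := by
      ext x; simp only [Finset.mem_sdiff, Finset.mem_insert]; grind
    -- The element `e` is not a loop of either matroid.
    have he1 : ρ₁ {e} = 1 := by
      have a1 := hk (insert e U) (Finset.insert_subset_insert e hU)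
      have a2 := h₁.insert_le e U
      have a3 := h₁.singleton_le e
      rw [hs1] at a1
      omega
    have he2 : ρ₂ {e} = 1 := by
      have a1 := hk U (hU.trans (Finset.subset_insert e A))
      have a2 := h₂.insert_le e (A \ U)
      have a3 := h₂.singleton_le e
      rw [hs2] at a1
      omega
    have p1 : ∀ V, 1 ≤ ρ₁ (insert e V) := fun V => by rw [← he1]; exact h₁.mono (by simp)
    have p2 : ∀ V, 1 ≤ ρ₂ (insert e V) := fun V => by rw [← he2]; exact h₂.mono (by simp)
    by_cases hcon : ∀ W ⊆ A, k - 1 ≤ (ρ₁ (insert e W) - 1) + (ρ₂ (insert e (A \ W)) - 1)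
    · obtain ⟨I, hI, hc, hr1, hr2⟩ := ih (h₁.contract he1) (h₂.contract he2) (k - 1) hcon
      have := p1 I; have := p2 I
      have heI : e ∉ I := fun h => he (hI h)
      exact ⟨insert e I, Finset.insert_subset_insert e hI,
        by rw [Finset.card_insert_of_notMem heI]; omega, by omega, by omega⟩
    push Not at hcon
    obtain ⟨W, hW, hWk⟩ := hcon
    have heW : e ∉ W := fun h => he (hW h)
    exfalso
    have a1 := h₁.submodular U (insert e W)
    have a2 := h₂.submodular (A \ U) (insert e (A \ W))
    have b1 := hk (U ∪ insert e W)
      (Finset.union_subset (hU.trans (Finset.subset_insert e A)) (Finset.insert_subset_insert e hW))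
    have b2 := hk (U ∩ insert e W)
      (Finset.inter_subset_left.trans (hU.trans (Finset.subset_insert e A)))
    have c1 : insert e A \ (U ∪ insert e W) = (A \ U) ∩ insert e (A \ W) := by
      ext x; simp only [Finset.mem_sdiff, Finset.mem_insert, Finset.mem_union, Finset.mem_inter]
      grind
    have c2 : insert e A \ (U ∩ insert e W) = (A \ U) ∪ insert e (A \ W) := by
      ext x; simp only [Finset.mem_sdiff, Finset.mem_insert, Finset.mem_union, Finset.mem_inter]
      grind
    rw [c1] at b1
    rw [c2] at b2
    have := p1 W; have := p2 (A \ W)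
    omega

end IsRankFunction

/-- A matroid of rank at most `k` on `n` elements in which every set `S` satisfies
`k * |S| ≤ n * ρ S` has `n` independent sets of size `k` which cover every element exactly `k`
times. They are the slices of a common independent set of the direct sum of `N` copies of the
matroid and of the matroid in which every element may be used at most `k` times. -/
theorem IsRankFunction.exists_uniform_cover {n k : ℕ} {ρ : Finset (Fin n) → ℕ}
    (h : IsRankFunction ρ) (hk : k ≤ n) (hρ : ρ Finset.univ ≤ k)
    (hdense : ∀ S, k * S.card ≤ n * ρ S) :
    ∃ B : Fin n → Finset (Fin n), (∀ i, (B i).card = k ∧ ρ (B i) = k) ∧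
      ∀ x, (Finset.univ.filter fun i => x ∈ B i).card = k := by
  classical
  let slice : Finset (Fin n × Fin n) → Fin n → Finset (Fin n) := fun U i =>
    Finset.univ.filter fun x => (i, x) ∈ U
  let mult : Finset (Fin n × Fin n) → Fin n → Finset (Fin n) := fun U x =>
    Finset.univ.filter fun i => (i, x) ∈ U
  have card_slice : ∀ U, ∑ i, (slice U i).card = U.card := fun U => by
    simp only [slice, Finset.card_filter]
    rw [← Fintype.sum_prod_type' (f := fun i x => if (i, x) ∈ U then 1 else 0)]
    simp
  have card_mult : ∀ U, ∑ x, (mult U x).card = U.card := fun U => by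
    simp only [mult, Finset.card_filter]
    rw [Finset.sum_comm, ← Fintype.sum_prod_type' (f := fun i x => if (i, x) ∈ U then 1 else 0)]
    simp
  have h₁ : IsRankFunction fun U => ∑ i, ρ (slice U i) := by
    refine ⟨?_, ?_, ?_, ?_⟩
    · simp [slice, h.empty]
    · intro S T hST
      exact Finset.sum_le_sum fun i _ => h.mono fun x hx => by
        simp only [slice, Finset.mem_filter] at hx ⊢
        exact ⟨hx.1, hST hx.2⟩
    · intro e
      calc ∑ i, ρ (slice {e} i) ≤ ∑ i, (slice {e} i).card :=
            Finset.sum_le_sum fun i _ => h.le_card _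
        _ = 1 := by rw [card_slice]; simp
    · intro S T
      rw [← Finset.sum_add_distrib, ← Finset.sum_add_distrib]
      refine Finset.sum_le_sum fun i _ => ?_
      have e1 : slice (S ∪ T) i = slice S i ∪ slice T i := by ext; simp [slice]
      have e2 : slice (S ∩ T) i = slice S i ∩ slice T i := by ext; simp [slice]
      rw [e1, e2]
      exact h.submodular _ _
  have h₂ : IsRankFunction fun U => ∑ x, min k (mult U x).card := by
    refine ⟨?_, ?_, ?_, ?_⟩
    · simp [mult]
    · intro S T hST
      refine Finset.sum_le_sum fun i _ => min_le_min_left k (Finset.card_le_card fun x hx => ?_)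
      simp only [mult, Finset.mem_filter] at hx ⊢
      exact ⟨hx.1, hST hx.2⟩
    · intro e
      calc ∑ x, min k (mult {e} x).card ≤ ∑ x, (mult {e} x).card :=
            Finset.sum_le_sum fun i _ => min_le_right _ _
        _ = 1 := by rw [card_mult]; simp
    · intro S T
      rw [← Finset.sum_add_distrib, ← Finset.sum_add_distrib]
      refine Finset.sum_le_sum fun i _ => ?_
      have e1 : mult (S ∪ T) i = mult S i ∪ mult T i := by ext; simp [mult]
      have e2 : mult (S ∩ T) i = mult S i ∩ mult T i := by ext; simp [mult]
      rw [e1, e2]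
      have := Finset.card_union_add_card_inter (mult S i) (mult T i)
      have := Finset.card_le_card (Finset.inter_subset_left (s₁ := mult S i) (s₂ := mult T i))
      have := Finset.card_le_card (Finset.inter_subset_right (s₁ := mult S i) (s₂ := mult T i))
      omega
  obtain ⟨I, -, hI, hI1, hI2⟩ := h₁.exists_common_independent h₂ Finset.univ (n * k) (by
    intro U _
    rcases Nat.eq_zero_or_pos n with rfl | hn
    · simp
    have e1 : n * ∑ i, ρ (slice U i) ≥ k * U.card := by
      rw [← card_slice, Finset.mul_sum, Finset.mul_sum]
      exact Finset.sum_le_sum fun i _ => hdense _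
    have e2 : n * ∑ x, min k (mult (Finset.univ \ U) x).card ≥ k * (Finset.univ \ U).card := by
      rw [← card_mult, Finset.mul_sum, Finset.mul_sum]
      refine Finset.sum_le_sum fun x _ => ?_
      have : (mult (Finset.univ \ U) x).card ≤ n := by
        simpa using Finset.card_le_univ (mult (Finset.univ \ U) x)
      rcases min_cases k (mult (Finset.univ \ U) x).card with ⟨h, -⟩ | ⟨h, -⟩ <;> rw [h] <;>
        nlinarith
    have e3 := Finset.card_sdiff_add_card_eq_card (Finset.subset_univ U)
    simp only [Finset.card_univ, Fintype.card_prod, Fintype.card_fin] at e3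
    refine Nat.le_of_mul_le_mul_left (c := n) ?_ hn
    nlinarith)
  have rank_le : ∀ i, ρ (slice I i) ≤ k := fun i => (h.mono (Finset.subset_univ _)).trans hρ
  have sumk : ∑ _i : Fin n, k = n * k := by simp
  have f1 : ∀ i, ρ (slice I i) = k := fun i =>
    (Finset.sum_eq_sum_iff_of_le (fun i _ => rank_le i)).1 (hI1.trans sumk.symm) i (Finset.mem_univ i)
  have f2 : ∀ i, ρ (slice I i) = (slice I i).card := fun i =>
    (Finset.sum_eq_sum_iff_of_le (fun i _ => h.le_card (slice I i))).1
      (hI1.trans (hI.symm.trans (card_slice I).symm)) i (Finset.mem_univ i)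
  have f3 : ∀ x, min k (mult I x).card = k := fun i =>
    (Finset.sum_eq_sum_iff_of_le (fun i _ => min_le_left _ _)).1 (hI2.trans sumk.symm) i
      (Finset.mem_univ i)
  have f4 : ∀ x, min k (mult I x).card = (mult I x).card := fun i =>
    (Finset.sum_eq_sum_iff_of_le (fun i _ => min_le_right _ _)).1
      (hI2.trans (hI.symm.trans (card_mult I).symm)) i (Finset.mem_univ i)
  refine ⟨slice I, fun i => ⟨(f2 i).symm.trans (f1 i), f1 i⟩, fun x => ?_⟩
  have : (Finset.univ.filter fun i => x ∈ slice I i) = mult I x := by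
    ext i; simp [slice, mult]
  rw [this]
  exact (f4 x).symm.trans (f3 x)

/-! ### Supports of subcodes -/

/-- The words of `C` which vanish on `S`. -/
def vanishingSubcode {F ι : Type*} [Field F] (C : Submodule F (ι → F)) (S : Set ι) :
    Submodule F (ι → F) :=
  C ⊓ Submodule.pi S fun _ => ⊥

theorem mem_vanishingSubcode {F ι : Type*} [Field F] {C : Submodule F (ι → F)} {S : Set ι}
    {x : ι → F} : x ∈ vanishingSubcode C S ↔ x ∈ C ∧ ∀ i ∈ S, x i = 0 := by
  simp [vanishingSubcode, Submodule.mem_pi]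

theorem finrank_eq_finrank_map_add_finrank_inf_ker {F V V' : Type*} [Field F] [AddCommGroup V]
    [Module F V] [AddCommGroup V'] [Module F V'] [FiniteDimensional F V] (W : Submodule F V)
    (φ : V →ₗ[F] V') :
    Module.finrank F W =
      Module.finrank F (W.map φ) + Module.finrank F (W ⊓ LinearMap.ker φ : Submodule F V) := by
  rw [← LinearMap.finrank_range_add_finrank_ker (φ.domRestrict W), LinearMap.range_domRestrict,
    LinearMap.ker_domRestrict]
  congr 1
  rw [← Submodule.map_comap_subtype]
  exact (LinearEquiv.finrank_eq (Submodule.equivMapOfInjective _ W.injective_subtype _))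

/-- The rank of the columns of a generator matrix in the positions `S` is
`dim C - dim {x ∈ C | x vanishes on S}`. -/
theorem isRankFunction_finrank_sub {F ι : Type*} [Field F] [Fintype ι] [DecidableEq ι]
    (C : Submodule F (ι → F)) :
    IsRankFunction fun S : Finset ι =>
      Module.finrank F C - Module.finrank F (vanishingSubcode C (S : Set ι)) where
  empty := by
    have : vanishingSubcode C ((∅ : Finset ι) : Set ι) = C := by
      ext x; simp [mem_vanishingSubcode]
    rw [this, Nat.sub_self]
  mono S T hST := by
    refine Nat.sub_le_sub_left (Submodule.finrank_mono fun x hx => ?_) _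
    rw [mem_vanishingSubcode] at hx ⊢
    exact ⟨hx.1, fun i hi => hx.2 i (hST hi)⟩
  singleton_le e := by
    have h := finrank_eq_finrank_map_add_finrank_inf_ker C (LinearMap.proj (φ := fun _ => F) e)
    have h2 : C ⊓ LinearMap.ker (LinearMap.proj (R := F) (φ := fun _ => F) e) =
        vanishingSubcode C (({e} : Finset ι) : Set ι) := by
      ext x; simp [mem_vanishingSubcode]
    have h3 := Submodule.finrank_le (C.map (LinearMap.proj (R := F) (φ := fun _ => F) e))
    rw [Module.finrank_self] at h3
    rw [h2] at h
    omega
  submodular S T := by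
    have h1 := Submodule.finrank_sup_add_finrank_inf_eq (vanishingSubcode C (S : Set ι))
      (vanishingSubcode C (T : Set ι))
    have h2 : vanishingSubcode C (S : Set ι) ⊓ vanishingSubcode C (T : Set ι) =
        vanishingSubcode C ((S ∪ T : Finset ι) : Set ι) := by
      ext x; simp only [Submodule.mem_inf, mem_vanishingSubcode]; simp; grind
    have h3 : vanishingSubcode C (S : Set ι) ⊔ vanishingSubcode C (T : Set ι) ≤
        vanishingSubcode C ((S ∩ T : Finset ι) : Set ι) := by
      refine sup_le ?_ ?_ <;> intro x <;> simp only [mem_vanishingSubcode] <;> simp <;> grind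
    have h4 := Submodule.finrank_mono h3
    have h5 : ∀ U : Finset ι, Module.finrank F (vanishingSubcode C (U : Set ι)) ≤
        Module.finrank F C := fun U => Submodule.finrank_mono inf_le_left
    have := h5 S; have := h5 T; have := h5 (S ∩ T); have := h5 (S ∪ T)
    rw [h2] at h1
    omega

theorem minDist_le_hammingNorm {F ι : Type*} [Field F] [DecidableEq F] [Fintype ι]
    {C : Submodule F (ι → F)} {x : ι → F} (hx : x ∈ C) (h0 : x ≠ 0) :
    minDist C ≤ hammingNorm x :=
  Nat.sInf_le ⟨x, hx, 0, C.zero_mem, h0, (hammingDist_zero_right x).symm⟩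

/-- A nonzero code of minimum distance at least `w` and dimension `κ` is not supported on fewer than
`κ + w - 1` positions: some nonzero word vanishes at `κ - 1` given positions. -/
theorem finrank_add_le_card_support {F ι : Type*} [Field F] [DecidableEq F] [Fintype ι]
    (W : Submodule F (ι → F)) (hW : 0 < Module.finrank F W) (w : ℕ)
    (hw : ∀ x ∈ W, x ≠ 0 → w ≤ hammingNorm x) (Z : Finset ι) (hZ : ∀ x ∈ W, ∀ i ∉ Z, x i = 0) :
    Module.finrank F W + w ≤ Z.card + 1 := by
  classical
  have key : ∀ A ⊆ Z, A.card < Module.finrank F W →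
      ∃ x ∈ W, x ≠ 0 ∧ hammingNorm x ≤ Z.card - A.card := by
    intro A hA hlt
    have h := finrank_eq_finrank_map_add_finrank_inf_ker W
      (LinearMap.funLeft F F (Subtype.val : A → ι))
    have h2 := Submodule.finrank_le (W.map (LinearMap.funLeft F F (Subtype.val : A → ι)))
    rw [Module.finrank_fintype_fun_eq_card, Fintype.card_coe] at h2
    have h3 : W ⊓ LinearMap.ker (LinearMap.funLeft F F (Subtype.val : A → ι)) ≠ ⊥ := by
      intro h4
      rw [h4, finrank_bot] at h
      omega
    obtain ⟨x, hx, h0⟩ := Submodule.exists_mem_ne_zero_of_ne_bot h3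
    rw [Submodule.mem_inf, LinearMap.mem_ker] at hx
    refine ⟨x, hx.1, h0, ?_⟩
    rw [← Finset.card_sdiff_of_subset hA]
    refine Finset.card_le_card fun i hi => ?_
    rw [Finset.mem_filter] at hi
    rw [Finset.mem_sdiff]
    refine ⟨by_contra fun h => hi.2 (hZ x hx.1 i h), fun h => hi.2 ?_⟩
    exact congrFun hx.2 ⟨i, h⟩
  by_cases hle : Module.finrank F W - 1 ≤ Z.card
  · obtain ⟨A, hA, hc⟩ := Finset.exists_subset_card_eq hle
    obtain ⟨x, hx, h0, hn⟩ := key A hA (by omega)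
    have := hw x hx h0
    omega
  · obtain ⟨x, hx, h0, hn⟩ := key Z subset_rfl (by omega)
    rw [Nat.sub_self, Nat.le_zero, hammingNorm_eq_zero] at hn
    exact absurd hn h0

/-! ### The counting inequality -/

theorem Finset.exists_subset_card_eq_forall_le {α : Type*} [DecidableEq α] (c : α → ℕ)
    (J : Finset α) (w : ℕ) (hw : w ≤ J.card) : ∃ R ⊆ J, R.card = w ∧ ∀ x ∈ R, ∀ y ∈ J \ R, c x ≤ c y := by
  induction w with
  | zero => exact ⟨∅, by simp⟩
  | succ w ih =>
    obtain ⟨R, hR, hc, h⟩ := ih (by omega)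
    have hne : (J \ R).Nonempty := by
      rw [← Finset.card_pos, Finset.card_sdiff_of_subset hR]; omega
    obtain ⟨e, he, hmin⟩ := Finset.exists_min_image _ c hne
    rw [Finset.mem_sdiff] at he
    refine ⟨insert e R, Finset.insert_subset he.1 hR, by
      rw [Finset.card_insert_of_notMem he.2, hc], ?_⟩
    intro x hx y hy
    have hy' : y ∈ J \ R := by
      simp only [Finset.mem_sdiff, Finset.mem_insert, not_or] at hy ⊢; tauto
    rcases Finset.mem_insert.1 hx with rfl | hx
    · exact hmin y hy'
    · exact h x hx y hy'

/-- The case of `finrank_mul_le_of_group_bounds` in which `t ≥ 2` and the code is too large for the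
bound on a single `T`: here `w = v - t + 1`, and `m` is a value of `c` which is at most `c j` for the
`j` in a suitable `T` and at least `c j` for the others. When the bound from the local groups is too
weak, `a` is so large that the bound from the stacked code suffices. -/
theorem support_bound_arith {κ N L r d a v t w m : ℕ} (hvL : v ≤ L) (hwt : w + t = v + 1)
    (ht : 2 ≤ t) (hm : m ≤ r) (hκm : κ ≤ w * m) (hκ : (w - 1) * r < κ) (hw : 1 ≤ w)
    (h1 : v * d + κ + (t - 1) * m ≤ N) (h2 : κ + a + v * d + t * m ≤ N + t * r) :
    κ * (L * (r + d) + a) ≤ L * r * N := by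
  obtain ⟨w, rfl⟩ := Nat.exists_eq_add_of_le' hw
  obtain ⟨t, rfl⟩ := Nat.exists_eq_add_of_le' ht
  obtain rfl : v = w + t + 2 := by omega
  obtain ⟨l, rfl⟩ := Nat.exists_eq_add_of_le hvL
  obtain ⟨q, rfl⟩ := Nat.exists_eq_add_of_le hm
  simp only [Nat.add_one_sub_one] at *
  set L := w + t + 2 + l with hL
  have hLd : κ * (L * d) ≤ L * (m + q) * ((w + t + 2) * d) := by
    have : κ ≤ (m + q) * (w + t + 2) := by nlinarith
    calc κ * (L * d) ≤ ((m + q) * (w + t + 2)) * (L * d) := Nat.mul_le_mul_right _ this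
      _ = _ := by ring
  -- It remains to see that the excess of `N` over `κ + v * d` is at least `κ * a / (L * r)`.
  by_cases hc : κ * a ≤ L * (m + q) * ((t + 1) * m)
  · have := Nat.mul_le_mul_left (L * (m + q)) h1
    nlinarith
  push Not at hc
  have hm0 : 0 < m := by
    rcases Nat.eq_zero_or_pos m with rfl | h
    · simp at hκm; omega
    · exact h
  have ha : L * (m + q) * (t + 1) ≤ (w + 1) * a := by
    refine Nat.le_of_mul_le_mul_right ?_ hm0
    nlinarith
  have hwq : w * q ≤ m := by nlinarith
  have h3 : κ * a + L * (m + q) * ((t + 2) * q) ≤ L * (m + q) * a := by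
    have h4 : (w + 1) * m * a + L * (m + q) * ((t + 2) * q) ≤ L * (m + q) * a := by
      have h5 : L * (m + q) = (w + 1) * m + ((t + 1 + l) * m + L * q) := by rw [hL]; ring
      have h6 : L * (m + q) * ((t + 2) * q) ≤ ((t + 1 + l) * m + L * q) * a := by
        refine Nat.le_of_mul_le_mul_left (c := w + 1) ?_ (by omega)
        have h7 := Nat.mul_le_mul_left ((t + 1 + l) * m + L * q) ha
        refine le_trans ?_ (h7.trans (le_of_eq (by ring)))
        have h8 : (w + 1) * ((t + 2) * q) ≤ ((t + 1 + l) * m + L * q) * (t + 1) := by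
          rw [hL]; nlinarith [Nat.zero_le (t * m), Nat.zero_le (l * m), Nat.zero_le (l * q),
            Nat.zero_le (t * q), Nat.zero_le (t * t * m), Nat.zero_le (t * t * q),
            Nat.zero_le (l * t * m), Nat.zero_le (l * t * q), Nat.zero_le (t * w * q)]
        calc (w + 1) * (L * (m + q) * ((t + 2) * q))
            = (L * (m + q)) * ((w + 1) * ((t + 2) * q)) := by ring
          _ ≤ (L * (m + q)) * (((t + 1 + l) * m + L * q) * (t + 1)) := Nat.mul_le_mul_left _ h8
          _ = _ := by ring
      calc _ ≤ (w + 1) * m * a + ((t + 1 + l) * m + L * q) * a := Nat.add_le_add_left h6 _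
        _ = _ := by rw [← Nat.add_mul, ← h5]
    exact le_trans (Nat.add_le_add_right (Nat.mul_le_mul_right _ hκm) _) h4
  have h9 : κ + a + (w + t + 2) * d ≤ N + (t + 2) * q := by nlinarith
  have := Nat.mul_le_mul_left (L * (m + q)) h9
  nlinarith

/-- Let a code of dimension `κ` be supported on `N` positions of a code with `L` local groups, and
let `J` be the set of groups on which it is not zero. Write `c j` for the dimension of its
projection to the group `j` and `Y T` for the dimension of the subcode which vanishes on the groups
of `J` outside `T`. Bounds on `N` in terms of `c` and `Y` imply
`κ / N ≤ (L * r) / (L * (r + d) + a)`. The relevant `T` are the sets of least size `t` with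
`Y T ≠ 0`: then `κ` is at most the sum of any `|J| - t + 1` of the `c j`. -/
theorem finrank_mul_le_of_group_bounds {ι : Type*} [DecidableEq ι] {κ N L r d a : ℕ}
    (J : Finset ι) (hJ : J.card ≤ L) (c : ι → ℕ) (hc : ∀ j, c j ≤ r) (Y : Finset ι → ℕ) (hκ : 0 < κ)
    (hY : Y ∅ = 0) (hdim : ∀ T ⊆ J, κ ≤ Y T + ∑ j ∈ J \ T, c j)
    (hloc : ∑ j ∈ J, (d + c j) ≤ N)
    (hsingle : ∀ j ∈ J, 0 < Y {j} → Y {j} + a + d + ∑ i ∈ J \ {j}, (d + c i) ≤ N)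
    (hsub : ∀ T ⊆ J, 0 < Y T → Y T + a + ∑ j ∈ J \ T, (d + c j) ≤ N)
    (hsub' : ∀ T ⊆ J, 0 < Y T → Y T + a + ∑ j ∈ J, (d + c j) ≤ N + T.card * r) :
    κ * (L * (r + d) + a) ≤ L * r * N := by
  classical
  have hYJ : 0 < Y J := by
    have := hdim J subset_rfl
    simp at this
    omega
  have hex : ∃ t, ∃ T ⊆ J, T.card = t ∧ 0 < Y T := ⟨_, J, subset_rfl, rfl, hYJ⟩
  -- `t` is the least number of groups on which a nonzero word can be concentrated.
  obtain ⟨T, hT, hTc, hYT⟩ := Nat.find_spec hex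
  have hmin : ∀ U ⊆ J, U.card < Nat.find hex → Y U = 0 := fun U hU hlt => by
    by_contra h
    exact Nat.find_min hex hlt ⟨U, hU, rfl, Nat.pos_of_ne_zero h⟩
  set t := Nat.find hex
  have htv : t ≤ J.card := hTc ▸ Finset.card_le_card hT
  have sum_le : ∀ U : Finset ι, ∑ j ∈ U, c j ≤ U.card * r := fun U =>
    Finset.sum_le_card_nsmul U c r fun j _ => hc j
  have sum_add : ∀ U : Finset ι, ∑ j ∈ U, (d + c j) = U.card * d + ∑ j ∈ U, c j := fun U => by
    rw [Finset.sum_add_distrib, Finset.sum_const, smul_eq_mul]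
  have card_sdiff : ∀ U ⊆ J, (J \ U).card + U.card = J.card := fun U hU =>
    Finset.card_sdiff_add_card_eq_card hU
  have hd := hdim T hT
  have hcT := card_sdiff T hT
  -- The case where `N` exceeds `κ + a` by the full redundancy of enough groups.
  have easy : ∀ s, s ≤ J.card → κ ≤ s * r → κ + a + s * d ≤ N →
      κ * (L * (r + d) + a) ≤ L * r * N := by
    intro s hs h1 h2
    have h3 : κ * (L * d) ≤ L * r * (s * d) := by
      calc κ * (L * d) ≤ (s * r) * (L * d) := Nat.mul_le_mul_right _ h1
        _ = _ := by ring
    have h4 : κ * a ≤ L * r * a :=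
      Nat.mul_le_mul_right _ (h1.trans (Nat.mul_le_mul_right _ (hs.trans hJ)))
    have := Nat.mul_le_mul_left (L * r) h2
    nlinarith
  have h2T := hsub T hT hYT
  rw [sum_add] at h2T
  by_cases hcase : κ ≤ (J.card - t) * r
  · refine easy (J.card - t) (by omega) hcase ?_
    have : J.card - t = (J \ T).card := by omega
    rw [this]
    omega
  have ht0 : t ≠ 0 := by
    intro h0
    rw [Finset.card_eq_zero.1 (hTc.trans h0), hY] at hYT
    exact lt_irrefl 0 hYT
  rcases Nat.lt_or_ge t 2 with ht1 | ht2
  · have ht1 : t = 1 := by omega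
    obtain ⟨j, rfl⟩ := Finset.card_eq_one.1 (hTc.trans ht1)
    have h3 := hsingle j (hT (Finset.mem_singleton_self j)) hYT
    rw [sum_add] at h3
    refine easy J.card le_rfl ?_ ?_
    · have h4 := hdim ∅ (Finset.empty_subset J)
      rw [hY, Finset.sdiff_empty, Nat.zero_add] at h4
      exact h4.trans (sum_le J)
    · have : J.card = (J \ {j}).card + 1 := by omega
      rw [this, Nat.add_mul, Nat.one_mul]
      omega
  obtain ⟨R, hR, hRc, hle⟩ :=
    Finset.exists_subset_card_eq_forall_le c J (J.card - t + 1) (by omega)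
  have hcR := card_sdiff R hR
  have hκR : κ ≤ ∑ j ∈ R, c j := by
    have h3 := hdim (J \ R) Finset.sdiff_subset
    rw [hmin (J \ R) Finset.sdiff_subset (by omega), Finset.sdiff_sdiff_eq_self hR] at h3
    omega
  -- `R` holds the smallest values of `c`. Its largest element `e` is added to the complement of `R`,
  -- which gives a set of `t` groups with values at least `c e`.
  obtain ⟨e, he, hmax⟩ := Finset.exists_max_image R c (Finset.card_pos.1 (by omega))
  have heJ : e ∉ J \ R := by simp [he]
  have hT'J : insert e (J \ R) ⊆ J := Finset.insert_subset (hR he) Finset.sdiff_subset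
  have hT'c : (insert e (J \ R)).card = t := by
    rw [Finset.card_insert_of_notMem heJ]; omega
  have hY' : 0 < Y (insert e (J \ R)) := by
    have h3 := hdim _ hT'J
    have h4 := sum_le (J \ insert e (J \ R))
    have h5 := card_sdiff _ hT'J
    have h6 : (J \ insert e (J \ R)).card = J.card - t := by omega
    rw [h6] at h4
    omega
  have hrest : (J \ R).card * c e ≤ ∑ j ∈ J \ R, c j :=
    Finset.card_nsmul_le_sum _ _ _ fun j hj => hle e he j hj
  have hsumJ := Finset.sum_sdiff (f := c) hR
  have hJR : (J \ R).card = t - 1 := by omega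
  rw [hJR] at hrest
  rw [sum_add] at hloc
  have hRmax : ∑ j ∈ R, c j ≤ R.card * c e := Finset.sum_le_card_nsmul _ _ _ fun j hj => hmax j hj
  rw [hRc] at hRmax
  refine support_bound_arith (v := J.card) (t := t) (w := J.card - t + 1) (m := c e) hJ (by omega)
    ht2 (hc e) (hκR.trans hRmax) (by rw [Nat.add_sub_cancel]; omega) (by omega) (by omega) ?_
  have h3 := hsub' _ hT'J hY'
  rw [hT'c, sum_add] at h3
  have h4 := hdim _ hT'J
  have h5 := Finset.sum_sdiff (f := c) hT'J
  rw [Finset.sum_insert heJ] at h5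
  have h6 : t * c e = (t - 1) * c e + c e := by
    conv_lhs => rw [show t = (t - 1) + 1 by omega]
    ring
  omega

/-! ### Supports of subcodes of local reconstruction codes -/

section LRC

variable {F : Type*} [Field F] {L r δ a : ℕ}

/-- Restriction of a word to the `j`-th local group. -/
def groupProj (F : Type*) [Field F] (L r δ a : ℕ) (j : Fin L) :
    (LRCCoord L r δ a → F) →ₗ[F] (Fin r ⊕ Fin (δ - 1) → F) :=
  LinearMap.funLeft F F fun x => Sum.inl (j, x)

/-- The word of the stacked code which is obtained by adding up the parities of the local groups. -/
def sumParities (F : Type*) [Field F] (L r δ a : ℕ) :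
    (LRCCoord L r δ a → F) →ₗ[F] ((Fin L × Fin r) ⊕ (Fin (δ - 1) ⊕ Fin a) → F) where
  toFun x := Sum.elim (fun p => x (Sum.inl (p.1, Sum.inl p.2)))
    (Sum.elim (fun i => ∑ j, x (Sum.inl (j, Sum.inr i))) fun i => x (Sum.inr i))
  map_add' x y := by
    ext i
    rcases i with i | i | i <;> simp [Finset.sum_add_distrib]
  map_smul' c x := by
    ext i
    rcases i with i | i | i <;> simp [Finset.mul_sum]

theorem mem_ker_lrcParityCheck {P : Fin L → Matrix (Fin (δ - 1)) (Fin r) F}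
    {M : Fin L → Matrix (Fin a) (Fin r) F} {x : LRCCoord L r δ a → F} :
    x ∈ LinearMap.ker (lrcParityCheck P M).mulVecLin ↔
      (∀ j i, ∑ c, P j i c * x (Sum.inl (j, Sum.inl c)) + x (Sum.inl (j, Sum.inr i)) = 0) ∧
      ∀ i, ∑ j, ∑ c, M j i c * x (Sum.inl (j, Sum.inl c)) + x (Sum.inr i) = 0 := by
  rw [LinearMap.mem_ker, funext_iff]
  simp only [Matrix.mulVecLin_apply, Sum.forall, Prod.forall, Pi.zero_apply]
  refine and_congr (forall_congr' fun j => forall_congr' fun i => ?_) (forall_congr' fun i => ?_)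
  · simp [lrcParityCheck, Matrix.mulVec, dotProduct, Fintype.sum_prod_type, ite_mul,
      Matrix.one_apply, Matrix.fromCols]
  · simp [lrcParityCheck, Matrix.mulVec, dotProduct, Fintype.sum_prod_type,
      Matrix.one_apply, Matrix.fromCols]

theorem sumParities_mem {P : Fin L → Matrix (Fin (δ - 1)) (Fin r) F}
    {M : Fin L → Matrix (Fin a) (Fin r) F} {x : LRCCoord L r δ a → F}
    (hx : x ∈ LinearMap.ker (lrcParityCheck P M).mulVecLin) :
    sumParities F L r δ a x ∈ LinearMap.ker (stackedParityCheck P M).mulVecLin := by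
  rw [mem_ker_lrcParityCheck] at hx
  rw [LinearMap.mem_ker, funext_iff]
  simp only [Matrix.mulVecLin_apply, Sum.forall, Pi.zero_apply]
  refine ⟨fun i => ?_, fun i => ?_⟩
  · have := Finset.sum_eq_zero fun j (_ : j ∈ Finset.univ) => hx.1 j i
    rw [Finset.sum_add_distrib] at this
    simpa [stackedParityCheck, Matrix.mulVec, dotProduct, Fintype.sum_prod_type, sumParities,
      Matrix.fromCols, Matrix.one_apply] using this
  · simpa [stackedParityCheck, Matrix.mulVec, dotProduct, Fintype.sum_prod_type, sumParities,
      Matrix.fromCols, Matrix.one_apply] using hx.2 i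

theorem eq_zero_of_sumParities_eq_zero {P : Fin L → Matrix (Fin (δ - 1)) (Fin r) F}
    {M : Fin L → Matrix (Fin a) (Fin r) F} {x : LRCCoord L r δ a → F}
    (hx : x ∈ LinearMap.ker (lrcParityCheck P M).mulVecLin)
    (h0 : sumParities F L r δ a x = 0) : x = 0 := by
  rw [mem_ker_lrcParityCheck] at hx
  have hu : ∀ j c, x (Sum.inl (j, Sum.inl c)) = 0 := fun j c => congrFun h0 (Sum.inl (j, c))
  have hg : ∀ i, x (Sum.inr i) = 0 := fun i => congrFun h0 (Sum.inr (Sum.inr i))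
  funext i
  rcases i with ⟨j, c | i⟩ | i
  · exact hu j c
  · simpa [hu] using hx.1 j i
  · exact hg i

/-- The subcode of the words which vanish on the local groups in `R`. -/
abbrev offGroups (D : Submodule F (LRCCoord L r δ a → F)) (R : Finset (Fin L)) :
    Submodule F (LRCCoord L r δ a → F) :=
  vanishingSubcode D {i | ∃ j ∈ R, ∃ x, i = Sum.inl (j, x)}

theorem mem_offGroups {D : Submodule F (LRCCoord L r δ a → F)} {R : Finset (Fin L)}
    {x : LRCCoord L r δ a → F} :
    x ∈ offGroups D R ↔ x ∈ D ∧ ∀ j ∈ R, groupProj F L r δ a j x = 0 := by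
  rw [mem_vanishingSubcode]
  refine and_congr_right fun _ => ⟨fun h j hj => funext fun i => h _ ⟨j, hj, i, rfl⟩, ?_⟩
  rintro h _ ⟨j, hj, i, rfl⟩
  exact congrFun (h j hj) i

theorem finrank_le_finrank_offGroups_add (D : Submodule F (LRCCoord L r δ a → F))
    (R : Finset (Fin L)) :
    Module.finrank F D ≤ Module.finrank F (offGroups D R) +
      ∑ j ∈ R, Module.finrank F (D.map (groupProj F L r δ a j)) := by
  induction R using Finset.induction_on with
  | empty =>
    have : offGroups D ∅ = D := by ext x; simp [mem_offGroups]
    rw [this]; simp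
  | insert e R he ih =>
    rw [Finset.sum_insert he]
    have h1 := finrank_eq_finrank_map_add_finrank_inf_ker (offGroups D R) (groupProj F L r δ a e)
    have h2 : offGroups D R ⊓ LinearMap.ker (groupProj F L r δ a e) = offGroups D (insert e R) := by
      ext x
      simp only [Submodule.mem_inf, mem_offGroups, LinearMap.mem_ker, Finset.forall_mem_insert]
      tauto
    rw [h2] at h1
    have h3 : Module.finrank F ((offGroups D R).map (groupProj F L r δ a e)) ≤
        Module.finrank F (D.map (groupProj F L r δ a e)) :=
      Submodule.finrank_mono (Submodule.map_mono inf_le_left)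
    omega

variable [DecidableEq F]

/-- The generalized Hamming weights of a local reconstruction code whose stacked code is MDS are as
large as uniform covering by information sets requires: a subcode has at most that proportion of the
dimension which its support has of the positions. -/
theorem finrank_mul_card_le {P : Fin L → Matrix (Fin (δ - 1)) (Fin r) F}
    {M : Fin L → Matrix (Fin a) (Fin r) F}
    (hloc : ∀ j, ∀ x ∈ LinearMap.ker (lrcParityCheck P M).mulVecLin,
      groupProj F L r δ a j x ≠ 0 → δ - 1 + 1 ≤ hammingNorm (groupProj F L r δ a j x))
    (hstack : ∀ y ∈ LinearMap.ker (stackedParityCheck P M).mulVecLin, y ≠ 0 →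
      δ - 1 + a + 1 ≤ hammingNorm y)
    (D : Submodule F (LRCCoord L r δ a → F))
    (hD : D ≤ LinearMap.ker (lrcParityCheck P M).mulVecLin)
    (Z : Finset (LRCCoord L r δ a)) (hZ : ∀ x ∈ D, ∀ i ∉ Z, x i = 0) :
    Module.finrank F D * (L * (r + (δ - 1)) + a) ≤ L * r * Z.card := by
  classical
  rcases Nat.eq_zero_or_pos (Module.finrank F D) with h0 | hpos
  · rw [h0]; simp
  let u : Fin L → ℕ := fun j => (Finset.univ.filter fun c => Sum.inl (j, Sum.inl c) ∈ Z).card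
  let p : Fin L → ℕ := fun j => (Finset.univ.filter fun i => Sum.inl (j, Sum.inr i) ∈ Z).card
  let g : ℕ := (Finset.univ.filter fun i => Sum.inr i ∈ Z).card
  have hcard : Z.card = ∑ j, (u j + p j) + g := by
    have : Z = Finset.univ.filter fun i => i ∈ Z := by simp
    rw [this, Finset.card_filter, Fintype.sum_sum_type, Fintype.sum_prod_type]
    simp only [Fintype.sum_sum_type, Finset.card_filter, u, p, g]
  have hu : ∀ j, u j ≤ r := fun j => by
    simpa using Finset.card_le_univ (Finset.univ.filter fun c => Sum.inl (j, Sum.inl c) ∈ Z)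
  let c : Fin L → ℕ := fun j => Module.finrank F (D.map (groupProj F L r δ a j))
  let J : Finset (Fin L) := Finset.univ.filter fun j => 0 < c j
  let Y : Finset (Fin L) → ℕ := fun T => Module.finrank F (offGroups D (J \ T))
  -- The support of the projection to a group.
  have hgroup : ∀ j ∈ J, δ - 1 + c j ≤ u j + p j := by
    intro j hj
    have h := finrank_add_le_card_support (D.map (groupProj F L r δ a j))
      (Finset.mem_filter.1 hj).2 (δ - 1 + 1) (by
        rintro _ ⟨x, hx, rfl⟩ hne
        exact hloc j x (hD hx) hne)
      (Finset.univ.filter fun i => Sum.inl (j, i) ∈ Z) (by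
        rintro _ ⟨x, hx, rfl⟩ i hi
        exact hZ x hx _ fun h => hi (by simpa using h))
    rw [Finset.card_filter, Fintype.sum_sum_type, ← Finset.card_filter, ← Finset.card_filter] at h
    change c j + (δ - 1 + 1) ≤ u j + p j + 1 at h
    omega
  -- Words of `D` vanish on the groups outside `J`.
  have hoff : ∀ T ⊆ J, ∀ x ∈ offGroups D (J \ T), ∀ j ∉ T, groupProj F L r δ a j x = 0 := by
    intro T hT x hx j hj
    rw [mem_offGroups] at hx
    by_cases hjJ : j ∈ J
    · exact hx.2 j (Finset.mem_sdiff.2 ⟨hjJ, hj⟩)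
    · have hc : c j = 0 := by simpa [J] using hjJ
      have := (Submodule.finrank_eq_zero).1 hc
      exact (Submodule.eq_bot_iff _).1 this _ ⟨x, hx.1, rfl⟩
  -- The support of the image of such a subcode in the stacked code.
  have hstacked : ∀ T ⊆ J, 0 < Y T → Y T + (δ - 1) + a ≤ ∑ j ∈ T, u j +
      (Finset.univ.filter fun i => ∃ j ∈ T, Sum.inl (j, Sum.inr i) ∈ Z).card + g := by
    intro T hT hY
    have hker : offGroups D (J \ T) ⊓ LinearMap.ker (sumParities F L r δ a) = ⊥ := by
      rw [Submodule.eq_bot_iff]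
      intro x hx
      exact eq_zero_of_sumParities_eq_zero (hD (mem_offGroups.1 hx.1).1) hx.2
    have hrank := finrank_eq_finrank_map_add_finrank_inf_ker (offGroups D (J \ T))
      (sumParities F L r δ a)
    rw [hker, finrank_bot, Nat.add_zero] at hrank
    let Z' : Finset ((Fin L × Fin r) ⊕ (Fin (δ - 1) ⊕ Fin a)) :=
      Finset.univ.filter (Sum.elim (fun q => q.1 ∈ T ∧ Sum.inl (q.1, Sum.inl q.2) ∈ Z)
        (Sum.elim (fun i => ∃ j ∈ T, Sum.inl (j, Sum.inr i) ∈ Z) fun i => Sum.inr i ∈ Z))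
    have h := finrank_add_le_card_support ((offGroups D (J \ T)).map (sumParities F L r δ a))
      (hrank ▸ hY) (δ - 1 + a + 1) (by
        rintro _ ⟨x, hx, rfl⟩ hne
        exact hstack _ (sumParities_mem (hD (mem_offGroups.1 hx).1)) hne) Z' (by
        rintro _ ⟨x, hx, rfl⟩ i hi
        have hxD := (mem_offGroups.1 hx).1
        rcases i with ⟨j, i⟩ | i | i
        · by_cases hj : j ∈ T
          · exact hZ x hxD _ fun h => hi (by simp [Z', hj, h])
          · exact congrFun (hoff T hT x hx j hj) (Sum.inl i)
        · change ∑ j, x (Sum.inl (j, Sum.inr i)) = 0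
          refine Finset.sum_eq_zero fun j _ => ?_
          by_cases hj : j ∈ T
          · exact hZ x hxD _ fun h => hi (by
              simp only [Z', Finset.mem_filter]
              exact ⟨Finset.mem_univ _, j, hj, h⟩)
          · exact congrFun (hoff T hT x hx j hj) (Sum.inr i)
        · exact hZ x hxD _ fun h => hi (by simp [Z', h]))
    have hZ' : Z'.card = ∑ j ∈ T, u j +
        ((Finset.univ.filter fun i => ∃ j ∈ T, Sum.inl (j, Sum.inr i) ∈ Z).card + g) := by
      simp only [Z', Finset.card_filter, Fintype.sum_sum_type, Fintype.sum_prod_type, Sum.elim_inl,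
        Sum.elim_inr, u, g]
      congr 1
      swap
      · congr 1 <;> exact Finset.sum_congr rfl fun _ _ => by congr
      rw [← Finset.sum_filter_add_sum_filter_not Finset.univ (· ∈ T)]
      rw [Finset.sum_eq_zero (s := Finset.univ.filter (· ∉ T)), Nat.add_zero]
      · rw [Finset.filter_univ_mem]
        refine Finset.sum_congr rfl fun j hj => Finset.sum_congr rfl fun i _ => ?_
        simp [hj]
      · intro j hj
        simp [(Finset.mem_filter.1 hj).2]
    rw [← hrank, hZ'] at h
    change Y T + (δ - 1 + a + 1) ≤ _ at h
    omega
  have hJle : ∑ j ∈ J, (u j + p j) + g ≤ Z.card := by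
    rw [hcard]
    exact Nat.add_le_add_right (Finset.sum_le_univ_sum_of_nonneg fun _ => Nat.zero_le _) _
  have hgroups : ∀ T ⊆ J, ∑ j ∈ T, (δ - 1 + c j) ≤ ∑ j ∈ T, (u j + p j) := fun T hT =>
    Finset.sum_le_sum fun j hj => hgroup j (hT hj)
  have hsplit : ∀ T ⊆ J, ∀ h : Fin L → ℕ, ∑ j ∈ J \ T, h j + ∑ j ∈ T, h j = ∑ j ∈ J, h j :=
    fun T hT h => Finset.sum_sdiff hT
  have hsub : ∀ T ⊆ J, 0 < Y T → Y T + a ≤ ∑ j ∈ T, u j + g := by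
    intro T hT hY
    have h1 := hstacked T hT hY
    have h2 := Finset.card_le_univ
      (Finset.univ.filter fun i : Fin (δ - 1) => ∃ j ∈ T, Sum.inl (j, Sum.inr i) ∈ Z)
    rw [Fintype.card_fin] at h2
    omega
  refine finrank_mul_le_of_group_bounds J (by simpa using Finset.card_le_univ J) c ?_ Y hpos ?_ ?_
    ?_ ?_ ?_ ?_
  · -- On a local group, words of the code are determined by the information symbols.
    intro j
    have h := finrank_eq_finrank_map_add_finrank_inf_ker (D.map (groupProj F L r δ a j))
      (LinearMap.funLeft F F (Sum.inl : Fin r → Fin r ⊕ Fin (δ - 1)))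
    have h2 := Submodule.finrank_le ((D.map (groupProj F L r δ a j)).map
      (LinearMap.funLeft F F (Sum.inl : Fin r → Fin r ⊕ Fin (δ - 1))))
    rw [Module.finrank_fintype_fun_eq_card, Fintype.card_fin] at h2
    have h3 : D.map (groupProj F L r δ a j) ⊓
        LinearMap.ker (LinearMap.funLeft F F (Sum.inl : Fin r → Fin r ⊕ Fin (δ - 1))) = ⊥ := by
      rw [Submodule.eq_bot_iff]
      rintro _ ⟨⟨x, hx, rfl⟩, h0⟩
      have h0' : ∀ i, x (Sum.inl (j, Sum.inl i)) = 0 := fun i => congrFun h0 i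
      have hx' := (mem_ker_lrcParityCheck.1 (hD hx)).1 j
      funext i
      rcases i with i | i
      · exact h0' i
      · change x (Sum.inl (j, Sum.inr i)) = 0
        simpa [h0'] using hx' i
    rw [h3, finrank_bot] at h
    simp only [c]
    omega
  · have : offGroups D (J \ ∅) = ⊥ := by
      rw [Submodule.eq_bot_iff]
      intro x hx
      have hx0 := fun j => hoff ∅ (Finset.empty_subset J) x hx j (Finset.notMem_empty j)
      have hg := (mem_ker_lrcParityCheck.1 (hD (mem_offGroups.1 hx).1)).2
      have hx0' : ∀ j i, x (Sum.inl (j, i)) = 0 := fun j i => congrFun (hx0 j) i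
      funext i
      rcases i with ⟨j, i⟩ | i
      · exact hx0' j i
      · simpa [hx0'] using hg i
    change Module.finrank F (offGroups D (J \ ∅)) = 0
    rw [this, finrank_bot]
  · exact fun T _ => finrank_le_finrank_offGroups_add D (J \ T)
  · have := hgroups J subset_rfl
    omega
  · intro j hj hY
    have hjJ := Finset.singleton_subset_iff.2 hj
    have h1 := hstacked {j} hjJ hY
    have h2 := hgroups (J \ {j}) Finset.sdiff_subset
    have h3 := hsplit {j} hjJ fun j => u j + p j
    simp only [Finset.sum_singleton, Finset.mem_singleton, exists_eq_left] at h1 h3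
    change Y {j} + (δ - 1) + a ≤ u j + p j + g at h1
    omega
  · intro T hT hY
    have h1 := hsub T hT hY
    have h2 := hgroups (J \ T) Finset.sdiff_subset
    have h3 := hsplit T hT fun j => u j + p j
    rw [Finset.sum_add_distrib (s := T)] at h3
    omega
  · intro T hT hY
    have h1 := hsub T hT hY
    have h2 := hgroups J subset_rfl
    have h3 := hsplit T hT fun j => u j + p j
    have h4 := hsplit T hT fun j => δ - 1 + c j
    have h5 := hgroups T hT
    have h6 := hgroups (J \ T) Finset.sdiff_subset
    have h7 : ∑ j ∈ T, u j ≤ T.card * r := Finset.sum_le_card_nsmul T u r fun j _ => hu j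
    rw [Finset.sum_add_distrib (s := T)] at h3 h5
    omega

end LRC

/-! ### Information sets which cover the positions uniformly -/

/-- There are `n` information sets of the code which contain every position exactly `k` times: by
`finrank_mul_card_le`, applied to the words which vanish on `S`, the rank of every set `S` of
positions is at least `k * |S| / n`. -/
theorem exists_uniform_information_sets {F : Type*} [Field F] [DecidableEq F] {n k r δ L a : ℕ}
    (hkn : k < n) (hδ : 1 ≤ δ) (hL : L * r = k) {C : Submodule F (Fin n → F)}
    (hCk : Module.finrank F C = k) {e : Fin n ≃ LRCCoord L r δ a}
    {P : Fin L → Matrix (Fin (δ - 1)) (Fin r) F} {M : Fin L → Matrix (Fin a) (Fin r) F}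
    (hC : IsDistanceOptimalLRC C e P M)
    (hMDS : IsMDS (LinearMap.ker (stackedParityCheck P M).mulVecLin) k) :
    ∃ B : Fin n → Finset (Fin n),
      (∀ i, (B i).card = k ∧ vanishingSubcode C (B i : Set (Fin n)) = ⊥) ∧
      ∀ x, (Finset.univ.filter fun i => x ∈ B i).card = k := by
  have hn : L * (r + (δ - 1)) + a = n := by
    have := Fintype.card_congr e
    simpa using this.symm
  have hmem : ∀ y : Fin n → F,
      y ∈ C ↔ y ∘ e.symm ∈ LinearMap.ker (lrcParityCheck P M).mulVecLin := by
    intro y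
    rw [hC.parityCheck.2, LinearMap.mem_ker, LinearMap.mem_ker, Matrix.mulVecLin_apply,
      Matrix.mulVecLin_apply, Matrix.submatrix_mulVec_equiv]
    rfl
  have hloc : ∀ j, ∀ x ∈ LinearMap.ker (lrcParityCheck P M).mulVecLin,
      groupProj F L r δ a j x ≠ 0 → δ - 1 + 1 ≤ hammingNorm (groupProj F L r δ a j x) := by
    intro j x hx h0
    have hxC : x ∘ e ∈ C := by
      rw [hmem, Function.comp_assoc, Equiv.self_comp_symm, Function.comp_id]
      exact hx
    have h1 : groupProj F L r δ a j x ∈ puncture C (localCoord e j) :=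
      ⟨x ∘ e, hxC, by
        funext i
        simp [groupProj, localCoord, LinearMap.funLeft_apply]⟩
    have h2 := minDist_le_hammingNorm h1 h0
    rw [hC.local_minDist j] at h2
    omega
  have hstack : ∀ y ∈ LinearMap.ker (stackedParityCheck P M).mulVecLin, y ≠ 0 →
      δ - 1 + a + 1 ≤ hammingNorm y := by
    intro y hy h0
    have h1 := minDist_le_hammingNorm hy h0
    rw [hMDS.2] at h1
    simp only [Fintype.card_sum, Fintype.card_prod, Fintype.card_fin] at h1
    omega
  have hrank : ∀ S : Finset (Fin n),
      Module.finrank F (vanishingSubcode C (S : Set (Fin n))) ≤ k := fun S =>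
    hCk ▸ Submodule.finrank_mono inf_le_left
  obtain ⟨B, hB, hcount⟩ := (isRankFunction_finrank_sub C).exists_uniform_cover hkn.le
    (hCk ▸ Nat.sub_le _ _) (by
      intro S
      let D := (vanishingSubcode C (S : Set (Fin n))).map (LinearMap.funLeft F F e.symm)
      have hDr : Module.finrank F D =
          Module.finrank F (vanishingSubcode C (S : Set (Fin n))) :=
        (LinearEquiv.finrank_eq (Submodule.equivMapOfInjective _
          (LinearMap.funLeft_injective_of_surjective F F _ e.symm.surjective) _)).symm
      have h := finrank_mul_card_le hloc hstack D (by
          rintro _ ⟨x, hx, rfl⟩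
          exact (hmem x).1 (mem_vanishingSubcode.1 hx).1)
        (Sᶜ.map e.toEmbedding) (by
          rintro _ ⟨x, hx, rfl⟩ i hi
          refine (mem_vanishingSubcode.1 hx).2 _ ?_
          by_contra hS
          exact hi (Finset.mem_map.2 ⟨e.symm i, Finset.mem_compl.2 hS, by simp⟩))
      have hS := Finset.card_add_card_compl S
      rw [Fintype.card_fin] at hS
      rw [hDr, hn, hL, Finset.card_map] at h
      obtain ⟨κ', hκ⟩ := Nat.exists_eq_add_of_le (hrank S)
      simp only [hCk]
      have h2 : k - Module.finrank F (vanishingSubcode C (S : Set (Fin n))) = κ' := by omega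
      rw [h2]
      nlinarith)
  refine ⟨B, fun i => ⟨(hB i).1, ?_⟩, hcount⟩
  have h1 := (hB i).2
  have h2 := hrank (B i)
  rw [← Submodule.finrank_eq_zero]
  simp only [hCk] at h1
  omega

/-- Complements of uniformly covering information sets are correctable erasure patterns. -/
theorem exists_correctable_erasure_matrix {F : Type*} [Field F] {n k : ℕ}
    {C : Submodule F (Fin n → F)} {B : Fin n → Finset (Fin n)}
    (hB : ∀ i, (B i).card = k ∧ vanishingSubcode C (B i : Set (Fin n)) = ⊥)
    (hcount : ∀ x, (Finset.univ.filter fun i => x ∈ B i).card = k) :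
    ∃ E : Matrix (Fin n) (Fin n) Bool,
      IsRegularBinaryMatrix E (n - k) ∧ ∀ i, IsCorrectable C (E i) := by
  refine ⟨fun i x => decide (x ∉ B i), ⟨fun i => ?_, fun x => ?_⟩, fun i x hx y hy hxy => ?_⟩
  · have : (Finset.univ.filter fun x => decide (x ∉ B i) = true) = (B i)ᶜ := by ext; simp
    rw [this, Finset.card_compl, Fintype.card_fin, (hB i).1]
  · have : (Finset.univ.filter fun i => decide (x ∉ B i) = true) =
        (Finset.univ.filter fun i => x ∈ B i)ᶜ := by ext; simp
    rw [this, Finset.card_compl, Fintype.card_fin, hcount]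
  · rw [← sub_eq_zero]
    refine (Submodule.eq_bot_iff _).1 (hB i).2 _ (mem_vanishingSubcode.2 ⟨C.sub_mem hx hy, ?_⟩)
    intro l hl
    rw [Pi.sub_apply, hxy l (by simpa using hl), sub_self]

/-! ### Retrieval from interference known on information sets -/

section PIR

open scoped Matrix

variable {F K : Type*} [Field F] [Field K] [Algebra F K] {n k : ℕ}

/-- An information set `B` has a decoding matrix over `F`, which also decodes over extensions. -/
theorem exists_decoding_matrix {C : Submodule F (Fin n → F)} {G : Matrix (Fin k) (Fin n) F}
    (hG : IsGeneratorMatrix G C) {B : Finset (Fin n)}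
    (hB : vanishingSubcode C (B : Set (Fin n)) = ⊥) :
    ∃ A : Matrix (Fin n) (Fin k) F, (∀ l ∉ B, A l = 0) ∧ G * A = 1 := by
  classical
  let φ : (Fin k → F) →ₗ[F] (B → F) := (LinearMap.funLeft F F Subtype.val) ∘ₗ G.vecMulLinear
  have hφ : LinearMap.ker φ = ⊥ := by
    rw [LinearMap.ker_eq_bot']
    intro u hu
    have h1 : u ᵥ* G ∈ C := by
      rw [← hG.2, ← range_vecMulLinear]
      exact ⟨u, rfl⟩
    have h2 : u ᵥ* G = 0 := (Submodule.eq_bot_iff _).1 hB _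
      (mem_vanishingSubcode.2 ⟨h1, fun i hi => congrFun hu ⟨i, hi⟩⟩)
    have h3 := Matrix.vecMul_injective_iff.2 hG.1
    exact h3 (by simpa using h2)
  obtain ⟨ψ, hψ⟩ := φ.exists_leftInverse_of_injective hφ
  let A : Matrix (Fin n) (Fin k) F := fun l c =>
    if h : l ∈ B then ψ (Pi.single ⟨l, h⟩ 1) c else 0
  refine ⟨A, fun l hl => by funext c; simp [A, hl], ?_⟩
  ext i c
  have h1 := congrFun (LinearMap.congr_fun hψ (Pi.single i 1)) c
  have h2 : φ (Pi.single i 1) = fun l : B => G i l := by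
    funext l
    simp [φ, LinearMap.funLeft_apply]
  have h3 : ∀ y : B → F, ψ y c = ∑ l, y l * ψ (Pi.single l 1) c := fun y => by
    conv_lhs => rw [pi_eq_sum_univ' y]
    simp [Finset.sum_apply]
  rw [LinearMap.comp_apply, h2, h3] at h1
  rw [Matrix.mul_apply, Matrix.one_apply]
  have h4 : ∑ l, G i l * A l c = ∑ l ∈ B, G i l * A l c :=
    (Finset.sum_subset (Finset.subset_univ B) fun l _ hl => by simp [A, hl]).symm
  rw [h4, ← Finset.sum_coe_sort]
  simp only [A, Finset.coe_mem, dite_true]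
  rw [h1]
  simp [Pi.single_apply, eq_comm]

/-- The combination of message rows which belongs to a row of a query matrix. -/
def queriedMessage {f β : ℕ} (X : Files K f β k) (v : Fin f × Fin β → F) : Fin k → K :=
  fun c => ∑ p, algebraMap F K (v p) * X p.1 p.2 c

theorem queriedMessage_add {f β : ℕ} (X : Files K f β k) (v w : Fin f × Fin β → F) :
    queriedMessage X (v + w) = queriedMessage X v + queriedMessage X w := by
  funext c
  simp [queriedMessage, add_mul, Finset.sum_add_distrib]

theorem queriedMessage_zero {f β : ℕ} (X : Files K f β k) :
    queriedMessage X (0 : Fin f × Fin β → F) = 0 := by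
  funext c
  simp [queriedMessage]

theorem queriedMessage_single {f β : ℕ} (X : Files K f β k) (m : Fin f) (b : Fin β) :
    queriedMessage X (Pi.single (m, b) (1 : F)) = X m b := by
  funext c
  rw [queriedMessage, Finset.sum_eq_single (m, b)]
  · simp
  · intro p _ hp
    simp [hp]
  · simp

/-- Responses are symbols of encodings of combinations of message rows. -/
theorem response_eq {G : Matrix (Fin k) (Fin n) F} {f β d : ℕ} (X : Files K f β k) (l : Fin n)
    (Q : Matrix (Fin d) (Fin f × Fin β) F) (i : Fin d) :
    response G X l Q i = (queriedMessage X (Q i) ᵥ* G.map (algebraMap F K)) l := by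
  simp only [response, storedSymbol, queriedMessage, Matrix.mul_apply, Matrix.vecMul, dotProduct,
    Finset.mul_sum, Finset.sum_mul]
  rw [Finset.sum_comm]
  simp only [mul_assoc]

theorem eq_of_forall_mem_vecMul_eq {G : Matrix (Fin k) (Fin n) F} {B : Finset (Fin n)}
    (hB : ∃ A : Matrix (Fin n) (Fin k) F, (∀ l ∉ B, A l = 0) ∧ G * A = 1) {x y : Fin k → K}
    (h : ∀ l ∈ B, (x ᵥ* G.map (algebraMap F K)) l = (y ᵥ* G.map (algebraMap F K)) l) : x = y := by
  obtain ⟨A, hA, hGA⟩ := hB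
  have h1 : ∀ z : Fin k → K,
      z = (z ᵥ* G.map (algebraMap F K)) ᵥ* A.map (algebraMap F K) := fun z => by
    rw [Matrix.vecMul_vecMul, ← Matrix.map_mul, hGA]
    simp
  rw [h1 x, h1 y]
  funext c
  simp only [Matrix.vecMul, dotProduct] at h ⊢
  refine Finset.sum_congr rfl fun l _ => ?_
  by_cases hl : l ∈ B
  · rw [h l hl]
  · simp [hA l hl]

/-- File `m` can be retrieved if for each of its rows `b` there is an information set each of whose
nodes is asked for row `b`, up to an interfering combination `v`, which in turn is downloaded
without further symbols from all nodes of an information set. -/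
theorem exists_decode {G : Matrix (Fin k) (Fin n) F} {B : Fin n → Finset (Fin n)}
    (hB : ∀ s, ∃ A : Matrix (Fin n) (Fin k) F, (∀ l ∉ B s, A l = 0) ∧ G * A = 1) {f β : ℕ}
    {d : Fin n → ℕ} (Q : (l : Fin n) → Matrix (Fin (d l)) (Fin f × Fin β) F) (m : Fin f)
    (h : ∀ b : Fin β, ∃ s, ∀ l ∈ B s, ∃ i v s', Q l i = v + Pi.single (m, b) 1 ∧
      (v = 0 ∨ ∀ l' ∈ B s', ∃ i', Q l' i' = v)) :
    ∃ decode : ((l : Fin n) → Fin (d l) → K) → Matrix (Fin β) (Fin k) K,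
      ∀ X : Files K f β k, decode (fun l => response G X l (Q l)) = X m := by
  have key : ∀ X Y : Files K f β k, (fun l => response G X l (Q l)) =
      (fun l => response G Y l (Q l)) → X m = Y m := by
    intro X Y hXY
    have hres : ∀ l i, (queriedMessage X (Q l i) ᵥ* G.map (algebraMap F K)) l =
        (queriedMessage Y (Q l i) ᵥ* G.map (algebraMap F K)) l := fun l i => by
      rw [← response_eq, ← response_eq]
      exact congrFun (congrFun hXY l) i
    funext b
    obtain ⟨s, hs⟩ := h b
    refine eq_of_forall_mem_vecMul_eq (hB s) fun l hl => ?_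
    obtain ⟨i, v, s', hQ, hv⟩ := hs l hl
    have hvXY : queriedMessage X v = queriedMessage Y v := by
      rcases hv with rfl | hv
      · rw [queriedMessage_zero, queriedMessage_zero]
      · refine eq_of_forall_mem_vecMul_eq (hB s') fun l' hl' => ?_
        obtain ⟨i', hi'⟩ := hv l' hl'
        rw [← hi']
        exact hres l' i'
    have h1 := hres l i
    rw [hQ, queriedMessage_add, queriedMessage_add, queriedMessage_single, queriedMessage_single,
      hvXY, Matrix.add_vecMul, Matrix.add_vecMul] at h1
    exact add_left_cancel h1
  have hfac : Function.FactorsThrough (fun X : Files K f β k => X m)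
      (fun X l => response G X l (Q l)) := fun X Y hXY => key X Y hXY
  exact ⟨Function.extend (fun X l => response G X l (Q l)) (fun X => X m) 0,
    fun X => hfac.extend_apply 0 X⟩

theorem PMF.map_uniformOfFintype_equiv {α β : Type*} [Fintype α] [Nonempty α] [Fintype β]
    [Nonempty β] (σ : α ≃ β) : (PMF.uniformOfFintype α).map σ = PMF.uniformOfFintype β := by
  ext b
  rw [PMF.map_apply, tsum_eq_single (σ.symm b)]
  · simp [Fintype.card_congr σ]
  · intro x hx
    rw [if_neg]
    rintro rfl
    simp at hx

/-- If node `l` lies in `k` of the sets `B s`, the numbers `s` can be permuted so that these are the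
first `k` sets. -/
theorem exists_perm_lt_iff_mem (hkn : k ≤ n) {B : Fin n → Finset (Fin n)}
    (hcount : ∀ l, (Finset.univ.filter fun s => l ∈ B s).card = k) (l : Fin n) :
    ∃ φ : Equiv.Perm (Fin n), ∀ x, l ∈ B (φ x) ↔ (x : ℕ) < k := by
  have h1 : Fintype.card {x : Fin n // (x : ℕ) < k} = Fintype.card {s // l ∈ B s} := by
    rw [Fintype.card_subtype, Fintype.card_subtype, hcount l, Fin.card_filter_val_lt,
      min_eq_right hkn]
  obtain ⟨σ⟩ := Fintype.card_eq.1 h1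
  refine ⟨σ.extendSubtype, fun x => ⟨fun hx => ?_, fun hx => σ.extendSubtype_mem x hx⟩⟩
  by_contra h
  exact σ.extendSubtype_not_mem x h hx


/-! ### Protocols -/


theorem card_subtype_le_val : Fintype.card {x : Fin n // k ≤ (x : ℕ)} = n - k := by
  have h := Fintype.card_subtype_compl fun x : Fin n => (x : ℕ) < k
  have h2 : Fintype.card {x : Fin n // (x : ℕ) < k} = min n k := by
    rw [Fintype.card_subtype, Fin.card_filter_val_lt]
  rw [h2, Fintype.card_fin] at h
  simp only [not_lt] at h
  rw [h]
  omega

theorem card_subtype_le_apply {f : ℕ} (j : Fin f) :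
    Fintype.card {t : Fin f → Fin n // k ≤ (t j : ℕ)} = (n - k) * n ^ (f - 1) := by
  let σ : {t : Fin f → Fin n // k ≤ (t j : ℕ)} ≃
      {x : Fin n // k ≤ (x : ℕ)} × ({i : Fin f // i ≠ j} → Fin n) :=
    ((Equiv.funSplitAt j (Fin n)).subtypeEquiv fun _ => Iff.rfl).trans
      (Equiv.prodSubtypeFstEquivSubtypeProd (p := fun x : Fin n => k ≤ (x : ℕ)))
  rw [Fintype.card_congr σ, Fintype.card_prod, card_subtype_le_val]
  simp

theorem card_subtype_exists_le_apply {f : ℕ} (hkn : k ≤ n) :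
    Fintype.card {t : Fin f → Fin n // ∃ j, k ≤ (t j : ℕ)} = n ^ f - k ^ f := by
  have h := Fintype.card_subtype_compl fun t : Fin f → Fin n => ∀ j, (t j : ℕ) < k
  have h2 : Fintype.card {t : Fin f → Fin n // ∀ j, (t j : ℕ) < k} = k ^ f := by
    rw [Fintype.card_congr (Equiv.subtypePiEquivPi (p := fun _ (x : Fin n) => (x : ℕ) < k)),
      Fintype.card_pi]
    simp [Fintype.card_subtype, Fin.card_filter_val_lt, hkn]
  rw [h2] at h
  simpa only [not_forall, not_lt, Fintype.card_fun, Fintype.card_fin] using h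

/-- A protocol in which the queries to a node are uniformly distributed. All nodes are asked for the
same `k * n` random combinations, numbered by `(c, s)`; the nodes outside the information set `B s`
add a row of the requested file to their copy of the combination `(c, s)`. -/
theorem nonempty_pirProtocol_of_uniform [Fintype F] (hkn : k < n) {G : Matrix (Fin k) (Fin n) F}
    {B : Fin n → Finset (Fin n)}
    (hB : ∀ s, ∃ A : Matrix (Fin n) (Fin k) F, (∀ l ∉ B s, A l = 0) ∧ G * A = 1)
    (hcount : ∀ l, (Finset.univ.filter fun s => l ∈ B s).card = k) (f : ℕ) :
    Nonempty (PIRProtocol K G f (n * (n - k)) fun _ => k * n) := by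
  classical
  choose φ hφ using exists_perm_lt_iff_mem hkn.le hcount
  have hcard : Fintype.card (Fin n × {x : Fin n // k ≤ (x : ℕ)}) =
      Fintype.card (Fin (n * (n - k))) := by
    rw [Fintype.card_prod, Fintype.card_fin, Fintype.card_fin, card_subtype_le_val]
  obtain ⟨g⟩ := Fintype.card_eq.1 hcard
  let V := Fin f × Fin (n * (n - k)) → F
  let num : Fin (k * n) ≃ Fin k × Fin n := finProdFinEquiv.symm
  let offset : Fin f → Fin n → Fin (k * n) → V := fun m l i =>
    if h : k ≤ ((num i).2 : ℕ) then
      Pi.single (m, g (φ l ((num i).1.castLE hkn.le), ⟨(num i).2, h⟩)) 1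
    else 0
  let Q : Fin f → (Fin k × Fin n → V) → Fin n →
      Matrix (Fin (k * n)) (Fin f × Fin (n * (n - k))) F := fun m U l =>
    Matrix.of fun i => U ((num i).1, φ l (num i).2) + offset m l i
  have hQ : ∀ m U l p, Q m U l (num.symm p) = U (p.1, φ l p.2) +
      if h : k ≤ (p.2 : ℕ) then Pi.single (m, g (φ l (p.1.castLE hkn.le), ⟨p.2, h⟩)) 1 else 0 := by
    intro m U l p
    change U ((num (num.symm p)).1, φ l (num (num.symm p)).2) + offset m l (num.symm p) = _
    simp only [offset, Equiv.apply_symm_apply]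
  have huniform : ∀ l m, (PMF.uniformOfFintype (Fin k × Fin n → V)).map (fun U => Q m U l) =
      PMF.uniformOfFintype (Fin (k * n) → V) := by
    intro l m
    let σ : (Fin k × Fin n → V) ≃ (Fin (k * n) → V) :=
      (Equiv.arrowCongr (num.trans (Equiv.prodCongr (Equiv.refl _) (φ l))).symm
        (Equiv.refl V)).trans (Equiv.addRight (offset m l))
    exact PMF.map_uniformOfFintype_equiv σ
  refine ⟨⟨fun m => (PMF.uniformOfFintype (Fin k × Fin n → V)).map (Q m), ?_, ?_⟩⟩
  · intro l m m'
    rw [PMF.map_comp, PMF.map_comp]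
    exact (huniform l m).trans (huniform l m').symm
  · intro m Q' hQ'
    obtain ⟨U, -, rfl⟩ := (PMF.mem_support_map_iff _ _ _).1 hQ'
    refine exists_decode hB _ m fun b => ?_
    obtain ⟨⟨s, x, hx⟩, rfl⟩ := g.surjective b
    refine ⟨s, fun l hl => ?_⟩
    have hc : ((φ l).symm s : ℕ) < k := (hφ l _).1 (by rwa [Equiv.apply_symm_apply])
    have hcast : φ l (Fin.castLE hkn.le ⟨(φ l).symm s, hc⟩) = s := (φ l).apply_symm_apply s
    refine ⟨num.symm (⟨(φ l).symm s, hc⟩, x), U (⟨(φ l).symm s, hc⟩, φ l x), φ l x, ?_, Or.inr ?_⟩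
    · rw [hQ, dif_pos hx, hcast]
    · intro l' hl'
      have hx' : ((φ l').symm (φ l x) : ℕ) < k :=
        (hφ l' _).1 (by rwa [Equiv.apply_symm_apply])
      refine ⟨num.symm (⟨(φ l).symm s, hc⟩, (φ l').symm (φ l x)), ?_⟩
      rw [hQ, dif_neg (not_le.2 hx'), add_zero, Equiv.apply_symm_apply]

/-- The protocol of finite capacity. The queries to a node are numbered by pairs `(c, t)`, where
`c < k` and `t` is a tuple of `f` numbers below `n` which are not all smaller than `k`; the query
`(c, t)` asks for the sum of one row of each file `j` with `k ≤ t j`. When file `m` is requested,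
the nodes of the information set `B s` download the sum of the rows of the other files which belongs
to `c`, `s` and the entries of `t` outside `m`, and the other nodes add a row of file `m` to it. The
rows of each file are permuted at random, so that a node only sees that its queries use distinct
rows of each file. -/
theorem nonempty_pirProtocol_of_permutation (hk : 0 < k) (hkn : k < n)
    {G : Matrix (Fin k) (Fin n) F} {B : Fin n → Finset (Fin n)}
    (hB : ∀ s, ∃ A : Matrix (Fin n) (Fin k) F, (∀ l ∉ B s, A l = 0) ∧ G * A = 1)
    (hcount : ∀ l, (Finset.univ.filter fun s => l ∈ B s).card = k) (f : ℕ) :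
    Nonempty (PIRProtocol K G f (n * ((n - k) * n ^ (f - 1))) fun _ => k * (n ^ f - k ^ f)) := by
  classical
  choose φ hφ using exists_perm_lt_iff_mem hkn.le hcount
  set β := n * ((n - k) * n ^ (f - 1)) with hβ
  have hβ0 : 0 < β := by
    have h1 : 0 < n := by omega
    have h2 : 0 < n - k := by omega
    positivity
  -- Numbering of the rows of file `j` by the pairs `(s, t)` with `k ≤ t j`.
  have hg : ∀ j : Fin f, ∃ g : Fin n × (Fin f → Fin n) → Fin β,
      Set.BijOn g {p | k ≤ (p.2 j : ℕ)} Set.univ := by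
    intro j
    have hcard : Fintype.card (Fin n × {t : Fin f → Fin n // k ≤ (t j : ℕ)}) =
        Fintype.card (Fin β) := by
      rw [Fintype.card_prod, Fintype.card_fin, Fintype.card_fin, card_subtype_le_apply]
    obtain ⟨σ⟩ := Fintype.card_eq.1 hcard
    refine ⟨fun p => if h : k ≤ (p.2 j : ℕ) then σ (p.1, ⟨p.2, h⟩) else ⟨0, hβ0⟩,
      fun _ _ => Set.mem_univ _, ?_, ?_⟩
    · rintro ⟨s, t⟩ h ⟨s', t'⟩ h' heq
      rw [Set.mem_ofPred_eq] at h h'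
      simp only [dif_pos h, dif_pos h', EmbeddingLike.apply_eq_iff_eq, Prod.mk.injEq,
        Subtype.mk.injEq] at heq
      rw [heq.1, heq.2]
    · intro b _
      obtain ⟨⟨s, t, ht⟩, rfl⟩ := σ.surjective b
      exact ⟨(s, t), ht, dif_pos ht⟩
  choose g hg using hg
  have hnum : Fintype.card (Fin (k * (n ^ f - k ^ f))) =
      Fintype.card (Fin k × {t : Fin f → Fin n // ∃ j, k ≤ (t j : ℕ)}) := by
    rw [Fintype.card_prod, Fintype.card_fin, Fintype.card_fin, card_subtype_exists_le_apply hkn.le]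
  obtain ⟨num⟩ := Fintype.card_eq.1 hnum
  let row : Fin f → Fin n → Fin k × (Fin f → Fin n) → Fin f → Fin β := fun m l p j =>
    if j = m then g j (φ l (p.1.castLE hkn.le), p.2)
    else g j (p.1.castLE hkn.le, Function.update p.2 m (φ l (p.2 m)))
  have hrow : ∀ m l j, Function.Injective
      fun p : {p : Fin k × (Fin f → Fin n) // k ≤ (p.2 j : ℕ)} => row m l p.1 j := by
    rintro m l j ⟨⟨c, t⟩, h⟩ ⟨⟨c', t'⟩, h'⟩ heq
    simp only [row] at heq h h'
    by_cases hj : j = m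
    · rw [if_pos hj, if_pos hj] at heq
      have h1 := (hg j).injOn (by exact h) (by exact h') heq
      simp only [Prod.mk.injEq, EmbeddingLike.apply_eq_iff_eq, Fin.castLE_inj] at h1
      rw [Subtype.mk.injEq, Prod.mk.injEq]
      exact h1
    · rw [if_neg hj, if_neg hj] at heq
      have h1 := (hg j).injOn (by simpa [Function.update_of_ne hj] using h)
        (by simpa [Function.update_of_ne hj] using h') heq
      simp only [Prod.mk.injEq, Fin.castLE_inj] at h1
      rw [Subtype.mk.injEq, Prod.mk.injEq]
      refine ⟨h1.1, funext fun i => ?_⟩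
      have h2 := congrFun h1.2 i
      by_cases hi : i = m
      · subst hi
        simpa using h2
      · simpa [Function.update_of_ne hi] using h2
  let Q : Fin f → (Fin f → Equiv.Perm (Fin β)) → Fin n →
      Matrix (Fin (k * (n ^ f - k ^ f))) (Fin f × Fin β) F := fun m π l =>
    Matrix.of fun i p => if k ≤ ((num i).2.1 p.1 : ℕ) ∧
      π p.1 (row m l ((num i).1, (num i).2.1) p.1) = p.2 then 1 else 0
  refine ⟨⟨fun m => (PMF.uniformOfFintype (Fin f → Equiv.Perm (Fin β))).map (Q m), ?_, ?_⟩⟩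
  · intro l m m'
    rw [PMF.map_comp, PMF.map_comp]
    have hτ : ∀ j, ∃ τ : Equiv.Perm (Fin β), ∀ p : Fin k × (Fin f → Fin n), k ≤ (p.2 j : ℕ) →
        τ (row m' l p j) = row m l p j := fun j => by
      obtain ⟨τ, hτ⟩ := Equiv.Perm.exists_extending_pair _ _ (hrow m' l j) (hrow m l j)
      exact ⟨τ, fun p hp => hτ ⟨p, hp⟩⟩
    choose τ hτ using hτ
    have h1 : (fun Q' : (l : Fin n) → _ => Q' l) ∘ Q m =
        ((fun Q' : (l : Fin n) → _ => Q' l) ∘ Q m') ∘ Equiv.mulRight τ := by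
      funext π
      ext i p
      simp only [Function.comp_apply, Q, Matrix.of_apply, Equiv.coe_mulRight, Pi.mul_apply,
        Equiv.Perm.mul_apply]
      refine if_congr (and_congr_right fun h => ?_) rfl rfl
      rw [hτ p.1 ((num i).1, (num i).2.1) h]
    rw [h1, ← PMF.map_comp, PMF.map_uniformOfFintype_equiv]
  · intro m Q' hQ'
    obtain ⟨π, -, rfl⟩ := (PMF.mem_support_map_iff _ _ _).1 hQ'
    refine exists_decode hB _ m fun b => ?_
    obtain ⟨⟨s, t⟩, ht, hst⟩ := (hg m).surjOn (Set.mem_univ ((π m).symm b))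
    rw [Set.mem_ofPred_eq] at ht
    refine ⟨s, fun l hl => ?_⟩
    have hc : ((φ l).symm s : ℕ) < k := (hφ l _).1 (by rwa [Equiv.apply_symm_apply])
    have hcast : φ l (Fin.castLE hkn.le ⟨(φ l).symm s, hc⟩) = s := (φ l).apply_symm_apply s
    set c : Fin k := ⟨(φ l).symm s, hc⟩
    set s' := φ l (t m) with hs'
    let v : Fin f × Fin β → F := fun p => if p.1 ≠ m ∧ k ≤ (t p.1 : ℕ) ∧
      π p.1 (g p.1 (c.castLE hkn.le, Function.update t m s')) = p.2 then 1 else 0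
    refine ⟨num.symm (c, ⟨t, m, ht⟩), v, s', ?_, ?_⟩
    · funext ⟨j, b'⟩
      simp only [Q, v, Matrix.of_apply, Equiv.apply_symm_apply, row, Pi.add_apply]
      by_cases hj : j = m
      · subst hj
        rw [if_pos rfl, hcast, hst, Equiv.apply_symm_apply]
        simp [ht, Pi.single_apply, eq_comm]
      · rw [if_neg hj]
        simp [hj, ← hs']
    · by_cases hex : ∃ j, j ≠ m ∧ k ≤ (t j : ℕ)
      · right
        intro l' hl'
        obtain ⟨j₀, hj₀, hjt⟩ := hex
        have hx' : ((φ l').symm s' : ℕ) < k := (hφ l' _).1 (by rwa [Equiv.apply_symm_apply])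
        refine ⟨num.symm (c, ⟨Function.update t m ((φ l').symm s'), j₀, by
          rwa [Function.update_of_ne hj₀]⟩), ?_⟩
        funext ⟨j, b'⟩
        simp only [Q, v, Matrix.of_apply, Equiv.apply_symm_apply, row]
        by_cases hj : j = m
        · subst hj
          simp [hx']
        · rw [if_neg hj]
          simp [hj]
      · left
        funext p
        push Not at hex
        exact if_neg fun h => absurd h.2.1 (not_le.2 (hex _ h.1))

end PIR

/-! ### Rates -/

theorem PIRProtocol.rate_eq_finiteCapacity {F K : Type*} [Field F] [Field K] [Algebra F K]
    {n k f : ℕ} {G : Matrix (Fin k) (Fin n) F} (hk : 0 < k) (hkn : k < n) (hf : 1 ≤ f)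
    (T : PIRProtocol K G f (n * ((n - k) * n ^ (f - 1))) fun _ => k * (n ^ f - k ^ f)) :
    T.rate = finiteCapacity n k f := by
  obtain ⟨f, rfl⟩ := Nat.exists_eq_add_of_le' hf
  have hpow : k ^ (f + 1) < n ^ (f + 1) := Nat.pow_lt_pow_left hkn (by omega)
  have hpow' : (k : ℝ) ^ (f + 1) < (n : ℝ) ^ (f + 1) := by exact_mod_cast hpow
  have hn : (n : ℝ) ≠ 0 := by
    have : n ≠ 0 := by omega
    exact_mod_cast this
  have hk' : (k : ℝ) ≠ 0 := by exact_mod_cast hk.ne'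
  have hd : (n : ℝ) ^ (f + 1) - (k : ℝ) ^ (f + 1) ≠ 0 := (sub_pos.2 hpow').ne'
  have h1 : 1 - ((k : ℝ) / n) ^ (f + 1) =
      ((n : ℝ) ^ (f + 1) - (k : ℝ) ^ (f + 1)) / (n : ℝ) ^ (f + 1) := by
    rw [div_pow]
    field_simp
  rw [PIRProtocol.rate, finiteCapacity, h1]
  simp only [Finset.sum_const, Finset.card_univ, Fintype.card_fin, nsmul_eq_mul]
  push_cast [Nat.cast_sub hkn.le, Nat.cast_sub hpow.le, Nat.add_sub_cancel]
  field_simp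
  ring

theorem PIRProtocol.rate_eq_asymptoticCapacity {F K : Type*} [Field F] [Field K] [Algebra F K]
    {n k f : ℕ} {G : Matrix (Fin k) (Fin n) F} (hk : 0 < k) (hkn : k < n)
    (T : PIRProtocol K G f (n * (n - k)) fun _ => k * n) : T.rate = asymptoticCapacity n k := by
  have hn : (n : ℝ) ≠ 0 := by
    have : n ≠ 0 := by omega
    exact_mod_cast this
  have hk' : (k : ℝ) ≠ 0 := by exact_mod_cast hk.ne'
  rw [PIRProtocol.rate, asymptoticCapacity]
  simp only [Finset.sum_const, Finset.card_univ, Fintype.card_fin, nsmul_eq_mul]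
  push_cast [Nat.cast_sub hkn.le]
  field_simp

theorem theorem2 {F K : Type*} [Field F] [Fintype F] [DecidableEq F]
    [Field K] [Fintype K] [Algebra F K]
    {n k r δ L a : ℕ} (hk : 0 < k) (hkn : k < n) (hδ : 1 ≤ δ) (hL : L * r = k)
    (C : Submodule F (Fin n → F)) (G : Matrix (Fin k) (Fin n) F) (hG : IsGeneratorMatrix G C)
    (e : Fin n ≃ LRCCoord L r δ a)
    (P : Fin L → Matrix (Fin (δ - 1)) (Fin r) F) (M : Fin L → Matrix (Fin a) (Fin r) F)
    (hC : IsDistanceOptimalLRC C e P M)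
    (hMDS : IsMDS (LinearMap.ker (stackedParityCheck P M).mulVecLin) k) :
    (∃ E : Matrix (Fin n) (Fin n) Bool,
        IsRegularBinaryMatrix E (n - k) ∧ ∀ i, IsCorrectable C (E i)) ∧
      IsMDSPIRCapacityAchieving K G := by
  have hCk : Module.finrank F C = k := by
    rw [← hG.2, finrank_span_eq_card hG.1, Fintype.card_fin]
  obtain ⟨B, hB, hcount⟩ := exists_uniform_information_sets hkn hδ hL hCk hC hMDS
  have hdec := fun s => exists_decoding_matrix hG (hB s).2
  refine ⟨exists_correctable_erasure_matrix hB hcount, fun f hf => ?_, ?_⟩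
  · obtain ⟨T⟩ := nonempty_pirProtocol_of_permutation (K := K) hk hkn hdec hcount f
    exact ⟨_, _, T, T.rate_eq_finiteCapacity hk hkn hf⟩
  · refine ⟨_, _, fun f =>
      Classical.choice (nonempty_pirProtocol_of_uniform (K := K) hkn hdec hcount f), ?_⟩
    simp only [PIRProtocol.rate_eq_asymptoticCapacity hk hkn]
    exact tendsto_const_nhds
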